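/- Let $\mathtt M$ be a model category (with all small limits and colimits and with functorial factorizations), and let $\mathtt{M}^{\mathtt I}$ be the category of cospans $C\to D\leftarrow B$ in $\mathtt M$, i.e. of functors from $\mathtt I=\{c\to d\leftarrow b\}$ to $\mathtt M$. Consider three structures $\sigma\in\{\mathrm{inj},\mathrm{Ree}_I,\mathrm{Ree}_D\}$ on $\mathtt M^{\mathtt I}$, all with the objectwise weak equivalences: the injective one (objectwise cofibrations; fibrations are the maps with the right lifting property against the maps that are objectwise cofibrations and objectwise weak equivalences), and the Reedy structures for the increasing labelling $0\to1\leftarrow2$ and the decreasing labelling $2\to1\leftarrow0$ of $\mathtt I$. Let $L:\mathtt M\to \mathrm{Ho}(\mathtt M)$ and $L_\sigma:\mathtt M^{\mathtt I}\to \mathrm{Ho}(\mathtt M^{\mathtt I}_\sigma)$ be localizations at the weak equivalences. A homotopy limit functor with respect to $\sigma$ is a functor $F:\mathrm{Ho}(\mathtt M^{\mathtt I}_\sigma)\to\mathrm{Ho}(\mathtt M)$ which is a right derived functor of $\mathrm{Lim}:\mathtt M^{\mathtt I}\to\mathtt M$, either * of Kan extension type: $F$, with some unit $L\circ\mathrm{Lim}\Rightarrow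 F\circ L_\sigma$, is a left Kan extension of $L\circ \mathrm{Lim}$ along $L_\sigma$; or * of strongly universal type: $F\circ L_\sigma\cong L\circ\mathrm{Lim}\circ R$ for some $\sigma$-fibrant C-replacement functor $R$ (an endofunctor with a natural trivial $\sigma$-cofibration $X\to RX$ and $RX$ $\sigma$-fibrant). An object $A$ of $\mathtt M$ is a homotopy pullback of a cospan $X$, of the given type and with respect to $\sigma$, if $L(A)\cong F(L_\sigma(X))$ for some such $F$. Write $A\approx A'$ if $A$ and $A'$ are connected by a zigzag of weak equivalences of $\mathtt M$. Then: 1. Each of the three structures $\sigma$ is a model structure with all small limits and colimits and functorial factorizations, and the adjunction (constant diagram) $\dashv\mathrm{Lim}$ between $\mathtt M$ and $\mathtt M^{\mathtt I}_\sigma$ is a Quillen adjunction. 2. For each $\sigma$, homotopy limit functors of both types exist. 3. They are independent of the type and of $\sigma$: if $F$ and $F'$ are homotopy limit functors of any types with respect to $\sigma$ and $\sigma'$, then $F\circ L_\sigma\cong F'\circ L_{\sigma'}$ as functors $\mathtt M^{\mathtt I}\to\mathrm{Ho}(\mathtt M)$. 4. Consequently, if $A\in\mathtt M$ is a homotopy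 pullback of $X$ of one type with respect to one $\sigma$, then for every type and every $\sigma'$, an object $A'\in\mathtt M$ is a homotopy pullback of $X$ of that type with respect to $\sigma'$ if and only if $A\approx A'$. The common class of objects is denoted by $B\times^h_DC$ for $X=(C\to D\leftarrow B)$. 5. If $(C\to D\leftarrow B)\to(C'\to D'\leftarrow B')$ is a morphism of cospans whose three components are weak equivalences, $B',C',D'$ are fibrant, and at least one of $C'\to D'$, $B'\to D'$ is a fibration, then $B\times^h_DC\approx B'\times_{D'}C'$. That is, for each type and each $\sigma$, an object $A$ is a homotopy pullback of $C\to D\leftarrow B$ if and only if $A\approx B'\times_{D'}C'$. -/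

import Mathlib

open CategoryTheory CategoryTheory.Limits HomotopicalAlgebra

universe v u v₁ u₁ v₂ u₂

noncomputable section

namespace HoPullback

/-! ### Model structures on a category -/

/-- Three classes of morphisms of a category. -/
structure MorphismClasses (C : Type*) [Category* C] where
  /-- the weak equivalences -/
  W : MorphismProperty C
  /-- the cofibrations -/
  cof : MorphismProperty C
  /-- the fibrations -/
  fib : MorphismProperty C

/-- The three distinguished classes of a model category. -/
def MorphismClasses.ofModelCategory (M : Type*) [Category* M] [ModelCategory M] :
    MorphismClasses M where
  W := weakEquivalences M
  cof := cofibrations M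
  fib := fibrations M

/-- The three classes are those of a model category which has all small limits and colimits
and functorial factorizations. -/
structure MorphismClasses.IsModelStructure {C : Type u} [Category.{v} C]
    (σ : MorphismClasses C) : Prop where
  hasLimits : HasLimits C
  hasColimits : HasColimits C
  exists_modelCategory : ∃ m : ModelCategory C,
    @weakEquivalences C _ m.categoryWithWeakEquivalences = σ.W ∧
    @cofibrations C _ m.categoryWithCofibrations = σ.cof ∧
    @fibrations C _ m.categoryWithFibrations = σ.fib
  trivCof_fib : MorphismProperty.HasFunctorialFactorization (σ.cof ⊓ σ.W) σ.fib
  cof_trivFib : MorphismProperty.HasFunctorialFactorization σ.cof (σ.fib ⊓ σ.W)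

/-- An adjunction is a Quillen adjunction: the left adjoint preserves cofibrations and
trivial cofibrations. -/
structure IsQuillenAdjunction {C D : Type*} [Category* C] [Category* D]
    (σ : MorphismClasses C) (τ : MorphismClasses D) {F : C ⥤ D} {G : D ⥤ C}
    (_adj : F ⊣ G) : Prop where
  cof {X Y : C} (f : X ⟶ Y) : σ.cof f → τ.cof (F.map f)
  trivCof {X Y : C} (f : X ⟶ Y) : (σ.cof ⊓ σ.W) f → (τ.cof ⊓ τ.W) (F.map f)

/-- A fibrant C-replacement functor: an endofunctor `R` with a natural trivial cofibration
`X ⟶ R X` to a fibrant object. -/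
structure FibrantCReplacement {C : Type*} [Category* C] [HasTerminal C]
    (σ : MorphismClasses C) where
  /-- the replacement functor -/
  R : C ⥤ C
  /-- the natural map to the replacement -/
  r : 𝟭 C ⟶ R
  trivCof (X : C) : (σ.cof ⊓ σ.W) (r.app X)
  fibrant (X : C) : σ.fib (terminal.from (R.obj X))

/-- A functorial factorization of the maps to the terminal object gives a fibrant
C-replacement functor. -/
def FibrantCReplacement.ofFactorization {C : Type*} [Category* C] [HasTerminal C]
    {σ : MorphismClasses C}
    (d : MorphismProperty.FunctorialFactorizationData (σ.cof ⊓ σ.W) σ.fib) :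
    FibrantCReplacement σ where
  R :=
    { obj X := d.Z.obj (Arrow.mk (terminal.from X))
      map f := d.Z.map (Arrow.homMk f (𝟙 _))
      map_id X := by
        rw [← d.Z.map_id]; rfl
      map_comp f g := by
        rw [← d.Z.map_comp]; congr 1; ext <;> simp }
  r :=
    { app X := d.i.app (Arrow.mk (terminal.from X))
      naturality X Y f := d.i.naturality
        (Arrow.homMk (u := f) (v := 𝟙 _) : Arrow.mk (terminal.from X) ⟶ Arrow.mk (terminal.from Y)) }
  trivCof X := d.hi _
  fibrant X := by
    have h := d.hp (Arrow.mk (terminal.from X))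
    have e : d.p.app (Arrow.mk (terminal.from X)) = terminal.from _ := terminal.hom_ext _ _
    rwa [e] at h

/-! ### Right derived functors -/

/-- The two notions of a right derived functor. -/
inductive DerivedKind
  /-- the derived functor is a Kan extension -/
  | kan
  /-- the derived functor is strongly universal -/
  | strong

/-- `RG` is a right derived functor of `G : C ⥤ M` with respect to localization functors
`LC` of `C` at the weak equivalences of `σ` and `L` on `M`.

* Kan extension type: `RG`, with some unit `G ⋙ L ⟶ LC ⋙ RG`, is a left Kan extension of
  `G ⋙ L` along `LC`.
* strongly universal type: `RG` is a factorization through `LC`, up to a natural isomorphism,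
  of `R ⋙ G ⋙ L`, for a fibrant C-replacement functor `R`. -/
def IsRightDerived {C M HC H : Type*} [Category* C] [Category* M] [Category* HC] [Category* H]
    [HasTerminal C] (σ : MorphismClasses C) (LC : C ⥤ HC) [LC.IsLocalization σ.W] (L : M ⥤ H)
    (G : C ⥤ M) (RG : HC ⥤ H) : DerivedKind → Prop
  | .kan => ∃ α : G ⋙ L ⟶ LC ⋙ RG, RG.IsRightDerivedFunctor α σ.W
  | .strong => ∃ R : FibrantCReplacement σ, Nonempty (R.R ⋙ G ⋙ L ≅ LC ⋙ RG)

/-- `A ≈ B`: the objects are connected by a zigzag of weak equivalences. -/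
def WeqZigzag {M : Type*} [Category* M] [CategoryWithWeakEquivalences M] (A B : M) : Prop :=
  Relation.EqvGen (fun X Y : M ↦ ∃ f : X ⟶ Y, WeakEquivalence f) A B

/-! ### Reedy model structures -/

section Reedy

variable {S : Type} [SmallCategory S]

/-- The full subcategory of the over-category `S₊ ↓ r` on the arrows other than the identity
of `r`, where `P` is the class of morphisms of the subcategory `S₊`. -/
abbrev LatchingCategory (P : MorphismProperty S) [P.IsMultiplicative] (r : S) : Type :=
  ObjectProperty.FullSubcategory
    (fun f : P.Over P r ↦ ¬ MorphismProperty.identities S (X := f.left) (Y := r) f.hom)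

/-- The forgetful functor to `S`. -/
def latchingForget (P : MorphismProperty S) [P.IsMultiplicative] (r : S) :
    LatchingCategory P r ⥤ S :=
  ObjectProperty.ι _ ⋙ MorphismProperty.Over.forget P P r ⋙ Over.forget r

/-- The full subcategory of the under-category `r ↓ S₋` on the arrows other than the identity
of `r`, where `P` is the class of morphisms of the subcategory `S₋`. -/
abbrev MatchingCategory (P : MorphismProperty S) [P.IsMultiplicative] (r : S) : Type :=
  ObjectProperty.FullSubcategory
    (fun f : P.Under P r ↦ ¬ MorphismProperty.identities S (X := r) (Y := f.right) f.hom)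

/-- The forgetful functor to `S`. -/
def matchingForget (P : MorphismProperty S) [P.IsMultiplicative] (r : S) :
    MatchingCategory P r ⥤ S :=
  ObjectProperty.ι _ ⋙ MorphismProperty.Under.forget P P r ⋙ Under.forget r

variable {M : Type u} [Category.{v} M]

section Latching

variable (P : MorphismProperty S) [P.IsMultiplicative] (r : S) [HasColimits M]

/-- The latching object `L_r X`. -/
abbrev latchingObj (X : S ⥤ M) : M := colimit (latchingForget P r ⋙ X)

/-- The latching morphism `L_r X ⟶ X_r`. -/
def latchingHom (X : S ⥤ M) : latchingObj P r X ⟶ X.obj r :=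
  colimit.desc (latchingForget P r ⋙ X)
    { pt := X.obj r
      ι :=
        { app f := X.map (Y := r) f.obj.hom
          naturality f g φ := by
            have h := Over.w ((MorphismProperty.Over.forget P P r).map φ.hom)
            have h' := congrArg X.map h
            rw [X.map_comp] at h'
            exact h'.trans (Category.comp_id _).symm } }

/-- The morphism `L_r X ⟶ L_r Y` induced by `f : X ⟶ Y`. -/
def latchingMap {X Y : S ⥤ M} (f : X ⟶ Y) : latchingObj P r X ⟶ latchingObj P r Y :=
  colimMap (Functor.whiskerLeft (latchingForget P r) f)

lemma latchingHom_naturality {X Y : S ⥤ M} (f : X ⟶ Y) :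
    latchingHom P r X ≫ f.app r = latchingMap P r f ≫ latchingHom P r Y := by
  apply colimit.hom_ext
  intro j
  simp only [latchingHom, latchingMap, colimit.ι_desc_assoc, ι_colimMap_assoc, colimit.ι_desc]
  exact f.naturality (Y := r) j.obj.hom

/-- The relative latching morphism `X_r ⨿_{L_r X} L_r Y ⟶ Y_r`. -/
def relLatching {X Y : S ⥤ M} (f : X ⟶ Y) :
    pushout (latchingHom P r X) (latchingMap P r f) ⟶ Y.obj r :=
  pushout.desc (f.app r) (latchingHom P r Y) (latchingHom_naturality P r f)

end Latching

section Matching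

variable (P : MorphismProperty S) [P.IsMultiplicative] (r : S) [HasLimits M]

/-- The matching object `M_r X`. -/
abbrev matchingObj (X : S ⥤ M) : M := limit (matchingForget P r ⋙ X)

/-- The matching morphism `X_r ⟶ M_r X`. -/
def matchingHom (X : S ⥤ M) : X.obj r ⟶ matchingObj P r X :=
  limit.lift (matchingForget P r ⋙ X)
    { pt := X.obj r
      π :=
        { app f := X.map (X := r) f.obj.hom
          naturality f g φ := by
            have h := Under.w ((MorphismProperty.Under.forget P P r).map φ.hom)
            have h' := congrArg X.map h
            rw [X.map_comp] at h'
            exact (Category.id_comp _).trans h'.symm } }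

/-- The morphism `M_r X ⟶ M_r Y` induced by `f : X ⟶ Y`. -/
def matchingMap {X Y : S ⥤ M} (f : X ⟶ Y) : matchingObj P r X ⟶ matchingObj P r Y :=
  limMap (Functor.whiskerLeft (matchingForget P r) f)

lemma matchingHom_naturality {X Y : S ⥤ M} (f : X ⟶ Y) :
    f.app r ≫ matchingHom P r Y = matchingHom P r X ≫ matchingMap P r f := by
  apply limit.hom_ext
  intro j
  simp only [matchingHom, matchingMap, Category.assoc, limit.lift_π, limMap_π,
    limit.lift_π_assoc]
  exact (f.naturality (X := r) j.obj.hom).symm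

/-- The relative matching morphism `X_r ⟶ Y_r ×_{M_r Y} M_r X`. -/
def relMatching {X Y : S ⥤ M} (f : X ⟶ Y) :
    X.obj r ⟶ pullback (matchingHom P r Y) (matchingMap P r f) :=
  pullback.lift (f.app r) (matchingHom P r X) (matchingHom_naturality P r f)

end Matching

variable [HasLimits M] [HasColimits M]

variable (M) in
/-- The Reedy weak equivalences, cofibrations and fibrations of `Fun(S, M)`, for a Reedy
structure on `S` with subcategories `S₋`, `S₊` given by `W₁`, `W₂`. -/
def reedyClasses [ModelCategory M] {W₁ W₂ : MorphismProperty S} [W₁.IsMultiplicative]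
    [W₂.IsMultiplicative] (_ρ : ReedyStructure W₁ W₂ ℕ) : MorphismClasses (S ⥤ M) where
  W := (weakEquivalences M).functorCategory S
  cof := fun _ _ f ↦ ∀ r : S, Cofibration (relLatching W₂ r f)
  fib := fun _ _ f ↦ ∀ r : S, Fibration (relMatching W₁ r f)

variable (S M) in
/-- The injective weak equivalences, cofibrations and fibrations of `Fun(S, M)`. -/
def injectiveClasses [ModelCategory M] : MorphismClasses (S ⥤ M) where
  W := (weakEquivalences M).functorCategory S
  cof := (cofibrations M).functorCategory S
  fib := ((cofibrations M).functorCategory S ⊓ (weakEquivalences M).functorCategory S).rlp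

end Reedy

/-! ### The three structures on cospans `c ⟶ d ⟵ b`

In `WalkingCospan` the objects `c`, `d`, `b` are `left`, `one`, `right`. -/

/-- The morphisms of `c ⟶ d ⟵ b` which do not raise the degree. -/
def degMinus (deg : WalkingCospan → ℕ) : MorphismProperty WalkingCospan :=
  fun i j _ ↦ deg j ≤ deg i

/-- The morphisms of `c ⟶ d ⟵ b` which do not lower the degree. -/
def degPlus (deg : WalkingCospan → ℕ) : MorphismProperty WalkingCospan :=
  fun i j _ ↦ deg i ≤ deg j

instance (deg : WalkingCospan → ℕ) : (degMinus deg).IsMultiplicative where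
  id_mem _ := le_refl _
  comp_mem _ _ hf hg := le_trans hg hf

instance (deg : WalkingCospan → ℕ) : (degPlus deg).IsMultiplicative where
  id_mem _ := le_refl _
  comp_mem _ _ hf hg := le_trans hf hg

lemma eq_or_eq_one_of_hom {X Y : WalkingCospan} (i : X ⟶ Y) : Y = X ∨ Y = .one := by
  change WidePullbackShape.Hom X Y at i
  cases i
  · exact Or.inl rfl
  · exact Or.inr rfl

lemma eq_or_eq_of_hom {X Z Y : WalkingCospan} (i : X ⟶ Z) (p : Z ⟶ Y) : Z = X ∨ Z = Y := by
  rcases eq_or_eq_one_of_hom i with rfl | rfl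
  · exact Or.inl rfl
  · rcases eq_or_eq_one_of_hom p with rfl | rfl <;> exact Or.inr rfl

/-- The Reedy structure on `c ⟶ d ⟵ b` given by an injective labelling of the objects. -/
def cospanReedy (deg : WalkingCospan → ℕ) (hdeg : Function.Injective deg) :
    ReedyStructure (degMinus deg) (degPlus deg) ℕ where
  deg := deg
  lt₁ {X Y} f hf hf' := by
    refine lt_of_le_of_ne hf fun h ↦ hf' ?_
    obtain rfl := hdeg h
    obtain rfl : f = 𝟙 _ := Subsingleton.elim _ _
    exact ⟨_⟩
  lt₂ {X Y} f hf hf' := by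
    refine lt_of_le_of_ne hf fun h ↦ hf' ?_
    obtain rfl := hdeg h
    obtain rfl : f = 𝟙 _ := Subsingleton.elim _ _
    exact ⟨_⟩
  nonempty_unique {X Y} f := by
    have : Subsingleton ((degMinus deg).MapFactorizationData (degPlus deg) f) := by
      refine ⟨fun a b ↦ ?_⟩
      have key (a : (degMinus deg).MapFactorizationData (degPlus deg) f) :
          deg a.Z = min (deg X) (deg Y) := by
        have h1 : deg a.Z ≤ deg X := a.hi
        have h2 : deg a.Z ≤ deg Y := a.hp
        rcases eq_or_eq_of_hom a.i a.p with h | h <;> rw [h] at h1 h2 ⊢ <;> omega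
      have hab : a.Z = b.Z := hdeg ((key a).trans (key b).symm)
      obtain ⟨Z, i, p, _, _, _⟩ := a
      obtain ⟨Z', i', p', _, _, _⟩ := b
      obtain rfl : Z = Z' := hab
      obtain rfl : i = i' := Subsingleton.elim _ _
      obtain rfl : p = p' := Subsingleton.elim _ _
      rfl
    rcases le_total (deg X) (deg Y) with h | h
    · exact ⟨@Unique.mk' _ ⟨⟨X, 𝟙 X, f, Category.id_comp f, le_refl (deg X), h⟩⟩ this⟩
    · exact ⟨@Unique.mk' _ ⟨⟨Y, f, 𝟙 Y, Category.comp_id f, h, le_refl (deg Y)⟩⟩ this⟩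

/-- The increasing labelling `0 ⟶ 1 ⟵ 2` of `c ⟶ d ⟵ b`. -/
def degIncreasing : WalkingCospan → ℕ
  | .left => 0
  | .one => 1
  | .right => 2

/-- The decreasing labelling `2 ⟶ 1 ⟵ 0` of `c ⟶ d ⟵ b`. -/
def degDecreasing : WalkingCospan → ℕ
  | .left => 2
  | .one => 1
  | .right => 0

lemma degIncreasing_injective : Function.Injective degIncreasing := by
  rintro (_ | _ | _) (_ | _ | _) h <;> first | rfl | (exfalso; revert h; decide)

lemma degDecreasing_injective : Function.Injective degDecreasing := by
  rintro (_ | _ | _) (_ | _ | _) h <;> first | rfl | (exfalso; revert h; decide)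

/-- The names of the three model structures on cospans. -/
inductive CospanStructure
  /-- the injective structure -/
  | inj
  /-- the Reedy structure of the increasing labelling -/
  | reedyI
  /-- the Reedy structure of the decreasing labelling -/
  | reedyD

/-- The weak equivalences, cofibrations and fibrations of the three model structures on the
category of cospans of `M`. -/
def cospanClasses (M : Type u) [Category.{v} M] [HasLimits M] [HasColimits M] [ModelCategory M] :
    CospanStructure → MorphismClasses (WalkingCospan ⥤ M)
  | .inj => injectiveClasses WalkingCospan M
  | .reedyI => reedyClasses M (cospanReedy degIncreasing degIncreasing_injective)
  | .reedyD => reedyClasses M (cospanReedy degDecreasing degDecreasing_injective)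

/-! ### Homotopy pullbacks -/

section HomotopyPullback

variable {M : Type u} [Category.{v} M] [HasLimits M] [HasColimits M] [ModelCategory M]
  {H HC : Type*} [Category* H] [Category* HC]

/-- `RLim` is a homotopy limit functor on cospans, of type `κ` and with respect to `σ`: a right
derived functor of the pullback functor. -/
def IsHomotopyLimit (κ : DerivedKind) (σ : CospanStructure) (L : M ⥤ H)
    (LC : (WalkingCospan ⥤ M) ⥤ HC) [LC.IsLocalization (cospanClasses M σ).W]
    (RLim : HC ⥤ H) : Prop :=
  IsRightDerived (cospanClasses M σ) LC L lim RLim κ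

/-- The object `A` of `M` is a homotopy pullback of the cospan `X`, of type `κ` and with respect
to `σ`: in the homotopy category it is the value at `X` of a homotopy limit functor. -/
def IsHomotopyPullback (κ : DerivedKind) (σ : CospanStructure) (L : M ⥤ H)
    (LC : (WalkingCospan ⥤ M) ⥤ HC) [LC.IsLocalization (cospanClasses M σ).W]
    (X : WalkingCospan ⥤ M) (A : M) : Prop :=
  ∃ RLim : HC ⥤ H, IsHomotopyLimit κ σ L LC RLim ∧ Nonempty (L.obj A ≅ RLim.obj (LC.obj X))

end HomotopyPullback

end HoPullback

end

/-! All three structures are cases of one construction on wide cospans, governed by a set `Λ` of at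
most one latching arm, the other arms being matching arms. No latching arm gives the injective
structure; the left or the right arm gives the Reedy structure of the increasing or the decreasing
labelling. A weak factorization system `(A, B)` on `M` induces one on wide cospans: lifts and
factorizations are built at the latching node, then at the vertex, where a pushout corner enters,
then independently at the matching nodes, where pullback corners enter. Intersecting with the
objectwise weak equivalences amounts to replacing `A` or `B` by its trivial version, so this one
statement, applied twice, yields the model structure (`isModelStructure_wideCospanClasses`). Corners
of constant diagrams are identities, hence the Quillen adjunction.

By Ken Brown's lemma `R ⋙ lim ⋙ L` inverts weak equivalences for every fibrant replacement `R`, and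
the functor it induces is derived in both senses. Replacements `R` for `σ` and `R'` for `τ` are
compared through `R ⋙ R'` as soon as `τ`-fibrations are `σ`-fibrations
(`FibrantCReplacement.nonempty_iso`). Injective fibrations are fibrations in all three structures,
so the injective replacement is a common reference, and every homotopy limit functor is isomorphic
to the one it computes.

To pass from functors to objects of `M`, a Whitehead argument shows that isomorphism in `Ho(M)` is
the same as a zigzag of weak equivalences (`weqZigzag_iff_nonempty_iso`). Finally, a cospan of
fibrant objects with one fibration is fibrant in the Reedy structure whose matching arm is that
fibration, so its actual limit is the homotopy pullback. -/

noncomputable section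

namespace HoPullback

/-! ### Relative pullback and pushout maps of a commutative square -/

section Corners

variable {C : Type*} [Category* C]

/-- The map from the corner `a` of a commutative square to the pullback of `b ⟶ d ⟵ c` belongs
to `B`. -/
def PullbackCorner (B : MorphismProperty C) {a b c d : C} (t : a ⟶ b) (l : a ⟶ c) (r : b ⟶ d)
    (u : c ⟶ d) : Prop :=
  ∃ (P : C) (p : P ⟶ b) (q : P ⟶ c) (k : a ⟶ P),
    IsPullback p q r u ∧ k ≫ p = t ∧ k ≫ q = l ∧ B k

/-- The map from the pushout of `b ⟵ a ⟶ c` to the corner `d` of a commutative square belongs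
to `A`. -/
def PushoutCorner (A : MorphismProperty C) {a b c d : C} (t : a ⟶ b) (l : a ⟶ c) (r : b ⟶ d)
    (u : c ⟶ d) : Prop :=
  ∃ (P : C) (p : b ⟶ P) (q : c ⟶ P) (k : P ⟶ d),
    IsPushout t l p q ∧ p ≫ k = r ∧ q ≫ k = u ∧ A k

/-- Any two pullbacks are canonically isomorphic, so the condition can be tested on whichever one is
at hand. -/
lemma pullbackCorner_iff {B : MorphismProperty C} [B.RespectsIso] {a b c d P : C} {t : a ⟶ b}
    {l : a ⟶ c} {r : b ⟶ d} {u : c ⟶ d} {p : P ⟶ b} {q : P ⟶ c} (hP : IsPullback p q r u)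
    {k : a ⟶ P} (hp : k ≫ p = t) (hq : k ≫ q = l) : PullbackCorner B t l r u ↔ B k := by
  refine ⟨?_, fun hk ↦ ⟨P, p, q, k, hP, hp, hq, hk⟩⟩
  rintro ⟨P', p', q', k', hP', hp', hq', hk'⟩
  have : k' ≫ (hP'.isoIsPullback _ _ hP).hom = k := hP.hom_ext (by simp [*]) (by simp [*])
  rw [← this]
  exact (B.cancel_right_of_respectsIso _ _).2 hk'

lemma pushoutCorner_iff {A : MorphismProperty C} [A.RespectsIso] {a b c d P : C} {t : a ⟶ b}
    {l : a ⟶ c} {r : b ⟶ d} {u : c ⟶ d} {p : b ⟶ P} {q : c ⟶ P} (hP : IsPushout t l p q)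
    {k : P ⟶ d} (hp : p ≫ k = r) (hq : q ≫ k = u) : PushoutCorner A t l r u ↔ A k := by
  refine ⟨?_, fun hk ↦ ⟨P, p, q, k, hP, hp, hq, hk⟩⟩
  rintro ⟨P', p', q', k', hP', hp', hq', hk'⟩
  have : (hP.isoIsPushout _ _ hP').hom ≫ k' = k := hP.hom_ext (by simp [*]) (by simp [*])
  rw [← this]
  exact (A.cancel_left_of_respectsIso _ _).2 hk'

end Corners

/-! ### Diagrams of the shape of a wide cospan -/

/-- The morphism from the node `j` to the vertex of a wide cospan. -/
def arm {J : Type*} (j : J) : Quiver.Hom (V := WidePullbackShape J) (some j) none :=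
  WidePullbackShape.Hom.term j

section WideCospan

variable {J : Type*} {C : Type*} [Category* C]

lemma wideCospan_ext {X Y : WidePullbackShape J ⥤ C} {f g : X ⟶ Y}
    (h₀ : f.app none = g.app none) (h : ∀ j, f.app (some j) = g.app (some j)) : f = g := by
  ext (_ | j)
  exacts [h₀, h j]

/-- Constructor for morphisms of wide cospans. -/
@[simps]
def wideCospanHomMk {X Y : WidePullbackShape J ⥤ C} (f₀ : X.obj none ⟶ Y.obj none)
    (f : ∀ j, X.obj (some j) ⟶ Y.obj (some j))
    (w : ∀ j, X.map (arm j) ≫ f₀ = f j ≫ Y.map (arm j)) : X ⟶ Y where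
  app
    | none => f₀
    | some j => f j
  naturality
    | _, _, .id _ => (congrArg (· ≫ _) (X.map_id _)).trans
        ((Category.id_comp _).trans ((Category.comp_id _).symm.trans
          (congrArg (_ ≫ ·) (Y.map_id _).symm)))
    | _, _, .term j => w j

/-- For a set of at most one latching arm, the maps of wide cospans which are relative
cofibrations for the class `A`. -/
structure IsRelCof (A : MorphismProperty C) (Λ : Option J) {X Y : WidePullbackShape J ⥤ C}
    (f : X ⟶ Y) : Prop where
  node (j : J) : A (f.app (some j))
  vertex (h : Λ = none) : A (f.app none)
  latching (j : J) (h : Λ = some j) :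
    PushoutCorner A (X.map (arm j)) (f.app (some j)) (f.app none) (Y.map (arm j))

/-- For a set of at most one latching arm, the maps of wide cospans which are relative
fibrations for the class `B`. -/
structure IsRelFib (B : MorphismProperty C) (Λ : Option J) {X Y : WidePullbackShape J ⥤ C}
    (f : X ⟶ Y) : Prop where
  vertex : B (f.app none)
  latching (j : J) (h : Λ = some j) : B (f.app (some j))
  matching (j : J) (h : Λ ≠ some j) :
    PullbackCorner B (X.map (arm j)) (f.app (some j)) (f.app none) (Y.map (arm j))

/-- The class of relative cofibrations. -/
def relCof (A : MorphismProperty C) (Λ : Option J) : MorphismProperty (WidePullbackShape J ⥤ C) :=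
  fun _ _ f ↦ IsRelCof A Λ f

/-- The class of relative fibrations. -/
def relFib (B : MorphismProperty C) (Λ : Option J) : MorphismProperty (WidePullbackShape J ⥤ C) :=
  fun _ _ f ↦ IsRelFib B Λ f

lemma app_comm {X Y Z W : WidePullbackShape J ⥤ C} {f : X ⟶ Y} {g : Y ⟶ W} {f' : X ⟶ Z}
    {g' : Z ⟶ W} (h : f ≫ g = f' ≫ g') (i : WidePullbackShape J) :
    f.app i ≫ g.app i = f'.app i ≫ g'.app i := by
  rw [← NatTrans.comp_app, h, NatTrans.comp_app]

/-- Lifting at a matching arm, relative to a lift at the vertex. -/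
lemma exists_lift_matching {B A : MorphismProperty C}
    (hAB : ∀ {U V X Y : C} (i : U ⟶ V) (p : X ⟶ Y), A i → B p → HasLiftingProperty i p)
    {U V X Y : WidePullbackShape J ⥤ C} {i : U ⟶ V} {p : X ⟶ Y} {t : U ⟶ X} {b : V ⟶ Y}
    (sq : t ≫ p = i ≫ b) (j : J) (hi : A (i.app (some j)))
    (hp : PullbackCorner B (X.map (arm j)) (p.app (some j)) (p.app none) (Y.map (arm j)))
    (l₀ : V.obj none ⟶ X.obj none) (h₁ : i.app none ≫ l₀ = t.app none)
    (h₂ : l₀ ≫ p.app none = b.app none) :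
    ∃ l : V.obj (some j) ⟶ X.obj (some j), i.app (some j) ≫ l = t.app (some j) ∧
      l ≫ p.app (some j) = b.app (some j) ∧ l ≫ X.map (arm j) = V.map (arm j) ≫ l₀ := by
  obtain ⟨P, fst, snd, k, hP, hk₁, hk₂, hk⟩ := hp
  have w : (V.map (arm j) ≫ l₀) ≫ p.app none = b.app (some j) ≫ Y.map (arm j) := by
    rw [Category.assoc, h₂, b.naturality]
  -- The pullback records both `b` at the node and the lift `l₀` at the vertex, so a lift against
  -- the corner map `k` is compatible with both.
  have sq' : CommSq (t.app (some j)) (i.app (some j)) k (hP.lift _ _ w) := ⟨hP.hom_ext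
    (by rw [Category.assoc, hk₁, Category.assoc, hP.lift_fst, ← t.naturality, ← h₁,
      i.naturality_assoc])
    (by simpa [hk₂] using app_comm sq (some j))⟩
  have := hAB _ _ hi hk
  refine ⟨sq'.lift, sq'.fac_left, ?_, ?_⟩
  · rw [← hk₂, sq'.fac_right_assoc, hP.lift_snd]
  · rw [← hk₁, sq'.fac_right_assoc, hP.lift_fst]

/-- Lifting at the vertex, relative to a lift at a latching arm. -/
lemma exists_lift_latching {B A : MorphismProperty C}
    (hAB : ∀ {U V X Y : C} (i : U ⟶ V) (p : X ⟶ Y), A i → B p → HasLiftingProperty i p)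
    {U V X Y : WidePullbackShape J ⥤ C} {i : U ⟶ V} {p : X ⟶ Y} {t : U ⟶ X} {b : V ⟶ Y}
    (sq : t ≫ p = i ≫ b) (j : J) (hp : B (p.app none))
    (hi : PushoutCorner A (U.map (arm j)) (i.app (some j)) (i.app none) (V.map (arm j)))
    (l : V.obj (some j) ⟶ X.obj (some j)) (h₁ : i.app (some j) ≫ l = t.app (some j))
    (h₂ : l ≫ p.app (some j) = b.app (some j)) :
    ∃ l₀ : V.obj none ⟶ X.obj none, i.app none ≫ l₀ = t.app none ∧
      l₀ ≫ p.app none = b.app none ∧ l ≫ X.map (arm j) = V.map (arm j) ≫ l₀ := by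
  obtain ⟨P, inl, inr, k, hP, hk₁, hk₂, hk⟩ := hi
  have w : U.map (arm j) ≫ t.app none = i.app (some j) ≫ (l ≫ X.map (arm j)) := by
    rw [reassoc_of% h₁, t.naturality]
  have sq' : CommSq (hP.desc _ _ w) k (p.app none) (b.app none) := ⟨hP.hom_ext
    (by simpa [reassoc_of% hk₁] using app_comm sq none)
    (by rw [hP.inr_desc_assoc, reassoc_of% hk₂, Category.assoc, p.naturality,
      reassoc_of% h₂, b.naturality])⟩
  have := hAB _ _ hk hp
  refine ⟨sq'.lift, ?_, sq'.fac_right, ?_⟩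
  · rw [← hk₁, Category.assoc, sq'.fac_left, hP.inl_desc]
  · rw [← hk₂, Category.assoc, sq'.fac_left, hP.inr_desc]

/-- Lifts are chosen in the order latching node, vertex, matching nodes. Each matching lift depends
only on the vertex, so the arms do not interact. -/
lemma hasLiftingProperty_relCof_relFib {B A : MorphismProperty C}
    (hAB : ∀ {U V X Y : C} (i : U ⟶ V) (p : X ⟶ Y), A i → B p → HasLiftingProperty i p)
    {Λ : Option J} {U V X Y : WidePullbackShape J ⥤ C} (i : U ⟶ V) (p : X ⟶ Y)
    (hi : relCof A Λ i) (hp : relFib B Λ p) : HasLiftingProperty i p where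
  sq_hasLift {t b} sq := by
    obtain ⟨l₀, h₁, h₂, hl⟩ : ∃ l₀ : V.obj none ⟶ X.obj none, i.app none ≫ l₀ = t.app none ∧
        l₀ ≫ p.app none = b.app none ∧ ∀ j, Λ = some j →
          ∃ l : V.obj (some j) ⟶ X.obj (some j), i.app (some j) ≫ l = t.app (some j) ∧
      l ≫ p.app (some j) = b.app (some j) ∧ l ≫ X.map (arm j) = V.map (arm j) ≫ l₀ := by
      cases hΛ : Λ with
      | none =>
        have := hAB _ _ (hi.vertex hΛ) hp.vertex
        have sq₀ : CommSq (t.app none) (i.app none) (p.app none) (b.app none) :=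
          ⟨app_comm sq.w none⟩
        exact ⟨sq₀.lift, by simp, by simp, by simp⟩
      | some j =>
        have := hAB _ _ (hi.node j) (hp.latching j hΛ)
        have sq₁ : CommSq (t.app (some j)) (i.app (some j)) (p.app (some j)) (b.app (some j)) :=
          ⟨app_comm sq.w (some j)⟩
        obtain ⟨l₀, h₁, h₂, h₃⟩ := exists_lift_latching hAB sq.w j hp.vertex (hi.latching j hΛ)
          sq₁.lift sq₁.fac_left sq₁.fac_right
        refine ⟨l₀, h₁, h₂, fun j' hj' ↦ ?_⟩
        obtain rfl := Option.some_injective _ hj'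
        exact ⟨sq₁.lift, by simp, by simp, h₃⟩
    have hl' (j : J) : ∃ l : V.obj (some j) ⟶ X.obj (some j), i.app (some j) ≫ l = t.app (some j) ∧
        l ≫ p.app (some j) = b.app (some j) ∧ l ≫ X.map (arm j) = V.map (arm j) ≫ l₀ := by
      by_cases hj : Λ = some j
      · exact hl j hj
      · exact exists_lift_matching hAB sq.w j (hi.node j) (hp.matching j hj) l₀ h₁ h₂
    choose l h₃ h₄ h₅ using hl'
    exact ⟨⟨{ l := wideCospanHomMk l₀ l fun j ↦ (h₅ j).symm
              fac_left := wideCospan_ext h₁ h₃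
              fac_right := wideCospan_ext h₂ h₄ }⟩⟩

/-! #### Factorizations -/

lemma exists_factorization_matching (A B : MorphismProperty C) [A.HasFactorization B]
    [HasPullbacks C] {X Y : WidePullbackShape J ⥤ C} (f : X ⟶ Y) (j : J) {Z₀ : C}
    (a₀ : X.obj none ⟶ Z₀) (b₀ : Z₀ ⟶ Y.obj none) (h : a₀ ≫ b₀ = f.app none) :
    ∃ (Z : C) (z : Z ⟶ Z₀) (a : X.obj (some j) ⟶ Z) (b : Z ⟶ Y.obj (some j)),
      X.map (arm j) ≫ a₀ = a ≫ z ∧ z ≫ b₀ = b ≫ Y.map (arm j) ∧ a ≫ b = f.app (some j) ∧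
      A a ∧ PullbackCorner B z b b₀ (Y.map (arm j)) := by
  have w : (X.map (arm j) ≫ a₀) ≫ b₀ = f.app (some j) ≫ Y.map (arm j) := by
    rw [Category.assoc, h, f.naturality]
  have hP := IsPullback.of_hasPullback b₀ (Y.map (arm j))
  have F := A.factorizationData B (hP.lift _ _ w)
  exact ⟨F.Z, F.p ≫ pullback.fst _ _, F.i, F.p ≫ pullback.snd _ _, by simp,
    by simp [pullback.condition], by simp, F.hi, _, _, _, F.p, hP, rfl, rfl, F.hp⟩

lemma hasFactorization_relCof_relFib (A B : MorphismProperty C) [A.HasFactorization B]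
    [HasPullbacks C] [HasPushouts C] (Λ : Option J) :
    (relCof A Λ).HasFactorization (relFib B Λ) where
  nonempty_mapFactorizationData {X Y} f := by
    obtain ⟨Z₀, a₀, b₀, hab₀, hb₀, ha₀, h⟩ : ∃ (Z₀ : C) (a₀ : X.obj none ⟶ Z₀)
        (b₀ : Z₀ ⟶ Y.obj none), a₀ ≫ b₀ = f.app none ∧ B b₀ ∧ (Λ = none → A a₀) ∧
        ∀ j, Λ = some j → ∃ (Z : C) (z : Z ⟶ Z₀) (a : X.obj (some j) ⟶ Z)
          (b : Z ⟶ Y.obj (some j)), X.map (arm j) ≫ a₀ = a ≫ z ∧ z ≫ b₀ = b ≫ Y.map (arm j) ∧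
          a ≫ b = f.app (some j) ∧ A a ∧ B b ∧ PushoutCorner A (X.map (arm j)) a a₀ z := by
      cases Λ with
      | none =>
        have F := A.factorizationData B (f.app none)
        exact ⟨F.Z, F.i, F.p, F.fac, F.hp, fun _ ↦ F.hi, by simp⟩
      | some j =>
        have F := A.factorizationData B (f.app (some j))
        have w : X.map (arm j) ≫ f.app none = F.i ≫ F.p ≫ Y.map (arm j) := by simp
        have hP := IsPushout.of_hasPushout (X.map (arm j)) F.i
        -- Factoring the map out of the pushout, rather than `f.app none`, puts the new pushout
        -- corner in `A`.
        have F' := A.factorizationData B (hP.desc _ _ w)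
        refine ⟨F'.Z, pushout.inl _ _ ≫ F'.i, F'.p, by simp, F'.hp, by simp, fun j' hj' ↦ ?_⟩
        obtain rfl := Option.some_injective _ hj'
        exact ⟨F.Z, pushout.inr _ _ ≫ F'.i, F.i, F.p, by simp [pushout.condition_assoc], by simp,
          F.fac, F.hi, F.hp, _, _, _, F'.i, hP, rfl, rfl, F'.hi⟩
    have h' (j : J) : ∃ (Z : C) (z : Z ⟶ Z₀) (a : X.obj (some j) ⟶ Z) (b : Z ⟶ Y.obj (some j)),
        X.map (arm j) ≫ a₀ = a ≫ z ∧ z ≫ b₀ = b ≫ Y.map (arm j) ∧ a ≫ b = f.app (some j) ∧ A a ∧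
        (Λ = some j → B b ∧ PushoutCorner A (X.map (arm j)) a a₀ z) ∧
        (Λ ≠ some j → PullbackCorner B z b b₀ (Y.map (arm j))) := by
      by_cases hj : Λ = some j
      · obtain ⟨Z, z, a, b, h₁, h₂, h₃, h₄, h₅⟩ := h j hj
        exact ⟨Z, z, a, b, h₁, h₂, h₃, h₄, fun _ ↦ h₅, fun h ↦ (h hj).elim⟩
      · obtain ⟨Z, z, a, b, h₁, h₂, h₃, h₄, h₅⟩ := exists_factorization_matching A B f j a₀ b₀ hab₀
        exact ⟨Z, z, a, b, h₁, h₂, h₃, h₄, fun h ↦ (hj h).elim, fun _ ↦ h₅⟩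
    choose Z z a b h₁ h₂ h₃ h₄ h₅ h₆ using h'
    exact ⟨{
      Z := WidePullbackShape.wideCospan Z₀ Z z
      i := wideCospanHomMk a₀ a h₁
      p := wideCospanHomMk b₀ b h₂
      fac := wideCospan_ext hab₀ h₃
      hi := ⟨h₄, ha₀, fun j hj ↦ (h₅ j hj).2⟩
      hp := ⟨hb₀, fun j hj ↦ (h₅ j hj).1, h₆⟩ }⟩

/-- A functorial factorization is a plain factorization of the universal arrow, a morphism of
functors on the arrow category `E`. Flipping turns it into a map of wide cospans in `E ⥤ C`, where
the non-functorial result applies to the objectwise classes; there `A` and `B` factor because they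
do so functorially in `C`. -/
lemma hasFunctorialFactorization_relCof_relFib (A B : MorphismProperty C)
    [A.HasFunctorialFactorization B] [HasPullbacks C] [HasPushouts C] (Λ : Option J) :
    (relCof A Λ).HasFunctorialFactorization (relFib B Λ) := by
  let E := Arrow (WidePullbackShape J ⥤ C)
  have := hasFactorization_relCof_relFib (A.functorCategory E) (B.functorCategory E) Λ
  have F := (relCof (A.functorCategory E) Λ).factorizationData (relFib (B.functorCategory E) Λ)
    ((flipFunctor _ _ _).map (Arrow.leftToRight (C := WidePullbackShape J ⥤ C)))
  refine ⟨⟨{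
    Z := F.Z.flip
    i := (flipFunctor _ _ _).map F.i
    p := (flipFunctor _ _ _).map F.p
    fac := by
      rw [← Functor.map_comp, F.fac]
      rfl
    hi := fun e ↦ ⟨fun j ↦ F.hi.node j e, fun h ↦ F.hi.vertex h e, fun j h ↦ ?_⟩
    hp := fun e ↦ ⟨F.hp.vertex e, fun j h ↦ F.hp.latching j h e, fun j h ↦ ?_⟩ }⟩⟩
  -- Evaluation at `e` preserves pushouts and pullbacks, so corners in `E ⥤ C` become corners in
  -- `C`.
  · obtain ⟨P, p, q, k, hP, hp, hq, hk⟩ := F.hi.latching j h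
    exact ⟨_, _, _, k.app e, hP.map ((evaluation E C).obj e), congr_app hp e, congr_app hq e, hk e⟩
  · obtain ⟨P, p, q, k, hP, hp, hq, hk⟩ := F.hp.matching j h
    exact ⟨_, _, _, k.app e, hP.map ((evaluation E C).obj e), congr_app hp e, congr_app hq e, hk e⟩

/-! #### Retracts -/

lemma app_of_retract {A : MorphismProperty C} [A.IsStableUnderRetracts]
    {X Y Z W : WidePullbackShape J ⥤ C} {f : X ⟶ Y} {g : Z ⟶ W} (h : RetractArrow f g)
    (i : WidePullbackShape J) (hg : A (g.app i)) : A (f.app i) :=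
  A.of_retract (h.map ((evaluation _ C).obj i)) hg

/-- Corner maps are functorial, so the corner of a retract is a retract of the corner. -/
lemma pullbackCorner_of_retract {B : MorphismProperty C} [B.IsStableUnderRetracts]
    [HasPullbacks C] {X Y Z W : WidePullbackShape J ⥤ C} {f : X ⟶ Y} {g : Z ⟶ W}
    (h : RetractArrow f g) (j : J)
    (hg : PullbackCorner B (Z.map (arm j)) (g.app (some j)) (g.app none) (W.map (arm j))) :
    PullbackCorner B (X.map (arm j)) (f.app (some j)) (f.app none) (Y.map (arm j)) := by
  obtain ⟨P, p, q, k, hP, hp, hq, hk⟩ := hg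
  let u : X ⟶ Z := h.i.left
  let u' : Y ⟶ W := h.i.right
  let v : Z ⟶ X := h.r.left
  let v' : W ⟶ Y := h.r.right
  have hu : u ≫ g = f ≫ u' := h.i_w
  have hv : v ≫ f = g ≫ v' := h.r_w
  have huv : u ≫ v = 𝟙 X := h.retract_left
  have huv' : u' ≫ v' = 𝟙 Y := h.retract_right
  have hQ := IsPullback.of_hasPullback (f.app none) (Y.map (arm j))
  have wk : X.map (arm j) ≫ f.app none = f.app (some j) ≫ Y.map (arm j) := f.naturality _
  have wi : (pullback.fst (f.app none) (Y.map (arm j)) ≫ u.app none) ≫ g.app none =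
      (pullback.snd _ _ ≫ u'.app (some j)) ≫ W.map (arm j) := by
    rw [Category.assoc, Category.assoc, app_comm hu, pullback.condition_assoc, u'.naturality]
  have wr : (p ≫ v.app none) ≫ f.app none = (q ≫ v'.app (some j)) ≫ Y.map (arm j) := by
    rw [Category.assoc, Category.assoc, app_comm hv, hP.w_assoc, v'.naturality]
  have e₁ (i) : u.app i ≫ v.app i = 𝟙 _ := by rw [← NatTrans.comp_app, huv]; rfl
  have e₂ (i) : u'.app i ≫ v'.app i = 𝟙 _ := by rw [← NatTrans.comp_app, huv']; rfl
  refine ⟨_, _, _, hQ.lift _ _ wk, hQ, by simp, by simp, ?_⟩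
  let ρ : RetractArrow (hQ.lift _ _ wk) k :=
    { i := Arrow.homMk (u.app (some j)) (hP.lift _ _ wi) (hP.hom_ext
        (by simp [hp]) (by simpa [hq] using app_comm hu (some j)))
      r := Arrow.homMk (v.app (some j)) (hQ.lift _ _ wr) (hQ.hom_ext
        (by simp [reassoc_of% hp]) (by simpa [reassoc_of% hq] using app_comm hv (some j)))
      retract := by
        ext
        · exact e₁ _
        · exact hQ.hom_ext (by simp [e₁]) (by simp [e₂]) }
  exact B.of_retract ρ hk

lemma pushoutCorner_of_retract {A : MorphismProperty C} [A.IsStableUnderRetracts]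
    [HasPushouts C] {X Y Z W : WidePullbackShape J ⥤ C} {f : X ⟶ Y} {g : Z ⟶ W}
    (h : RetractArrow f g) (j : J)
    (hg : PushoutCorner A (Z.map (arm j)) (g.app (some j)) (g.app none) (W.map (arm j))) :
    PushoutCorner A (X.map (arm j)) (f.app (some j)) (f.app none) (Y.map (arm j)) := by
  obtain ⟨P, p, q, k, hP, hp, hq, hk⟩ := hg
  let u : X ⟶ Z := h.i.left
  let u' : Y ⟶ W := h.i.right
  let v : Z ⟶ X := h.r.left
  let v' : W ⟶ Y := h.r.right
  have hu : u ≫ g = f ≫ u' := h.i_w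
  have hv : v ≫ f = g ≫ v' := h.r_w
  have huv : u ≫ v = 𝟙 X := h.retract_left
  have huv' : u' ≫ v' = 𝟙 Y := h.retract_right
  have hQ := IsPushout.of_hasPushout (X.map (arm j)) (f.app (some j))
  have wk : X.map (arm j) ≫ f.app none = f.app (some j) ≫ Y.map (arm j) := f.naturality _
  have wi : X.map (arm j) ≫ u.app none ≫ p = f.app (some j) ≫ u'.app (some j) ≫ q := by
    rw [u.naturality_assoc, hP.w, reassoc_of% app_comm hu]
  have wr : Z.map (arm j) ≫ v.app none ≫ pushout.inl (X.map (arm j)) (f.app (some j)) =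
      g.app (some j) ≫ v'.app (some j) ≫ pushout.inr _ _ := by
    rw [v.naturality_assoc, hQ.w, reassoc_of% app_comm hv]
  have e₁ (i) : u.app i ≫ v.app i = 𝟙 _ := by rw [← NatTrans.comp_app, huv]; rfl
  have e₂ (i) : u'.app i ≫ v'.app i = 𝟙 _ := by rw [← NatTrans.comp_app, huv']; rfl
  refine ⟨_, _, _, hQ.desc _ _ wk, hQ, by simp, by simp, ?_⟩
  let ρ : RetractArrow (hQ.desc _ _ wk) k :=
    { i := Arrow.homMk (hQ.desc _ _ wi) (u'.app none) (hQ.hom_ext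
        (by simpa [hp] using app_comm hu none) (by simp [hq]))
      r := Arrow.homMk (hP.desc _ _ wr) (v'.app none) (hP.hom_ext
        (by simpa [reassoc_of% hp] using app_comm hv none) (by simp [reassoc_of% hq]))
      retract := by
        ext
        · exact hQ.hom_ext (by simp [reassoc_of% e₁]) (by simp [reassoc_of% e₂])
        · exact e₂ _ }
  exact A.of_retract ρ hk

instance (A : MorphismProperty C) [A.IsStableUnderRetracts] [HasPushouts C] (Λ : Option J) :
    (relCof A Λ).IsStableUnderRetracts where
  of_retract h hg := ⟨fun j ↦ app_of_retract h _ (hg.node j),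
    fun hΛ ↦ app_of_retract h _ (hg.vertex hΛ),
    fun j hj ↦ pushoutCorner_of_retract h j (hg.latching j hj)⟩

instance (B : MorphismProperty C) [B.IsStableUnderRetracts] [HasPullbacks C] (Λ : Option J) :
    (relFib B Λ).IsStableUnderRetracts where
  of_retract h hg := ⟨app_of_retract h _ hg.vertex,
    fun j hj ↦ app_of_retract h _ (hg.latching j hj),
    fun j hj ↦ pullbackCorner_of_retract h j (hg.matching j hj)⟩

/-- The retract argument: lifting, factorization and closure under retracts force each class to be
determined by the other. -/
lemma isWeakFactorizationSystem_relCof_relFib (A B : MorphismProperty C)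
    [A.IsWeakFactorizationSystem B] [A.IsStableUnderRetracts] [B.IsStableUnderRetracts]
    [HasPullbacks C] [HasPushouts C] (Λ : Option J) :
    (relCof A Λ).IsWeakFactorizationSystem (relFib B Λ) :=
  have := hasFactorization_relCof_relFib A B Λ
  .mk' _ _ (hasLiftingProperty_relCof_relFib
    (fun i p hi hp ↦ MorphismProperty.hasLiftingProperty_of_wfs i p hi hp))

end WideCospan

/-! ### Model structures on wide cospans with at most one latching arm -/

section ModelStructure

lemma PullbackCorner.mono {C : Type*} [Category* C] {B B' : MorphismProperty C} (hB : B ≤ B')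
    {a b c d : C} {t : a ⟶ b} {l : a ⟶ c} {r : b ⟶ d} {u : c ⟶ d}
    (h : PullbackCorner B t l r u) : PullbackCorner B' t l r u := by
  obtain ⟨P, p, q, k, hP, hp, hq, hk⟩ := h
  exact ⟨P, p, q, k, hP, hp, hq, hB _ hk⟩

lemma PushoutCorner.mono {C : Type*} [Category* C] {A A' : MorphismProperty C} (hA : A ≤ A')
    {a b c d : C} {t : a ⟶ b} {l : a ⟶ c} {r : b ⟶ d} {u : c ⟶ d}
    (h : PushoutCorner A t l r u) : PushoutCorner A' t l r u := by
  obtain ⟨P, p, q, k, hP, hp, hq, hk⟩ := h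
  exact ⟨P, p, q, k, hP, hp, hq, hA _ hk⟩

lemma PullbackCorner.left {C : Type*} [Category* C] {B : MorphismProperty C}
    [B.IsStableUnderBaseChange] [B.IsStableUnderComposition]
    {a b c d : C} {t : a ⟶ b} {l : a ⟶ c} {r : b ⟶ d} {u : c ⟶ d}
    (h : PullbackCorner B t l r u) (hr : B r) : B l := by
  obtain ⟨P, p, q, k, hP, hp, hq, hk⟩ := h
  rw [← hq]
  exact B.comp_mem _ _ hk (B.of_isPullback hP hr)

lemma PushoutCorner.right {C : Type*} [Category* C] {A : MorphismProperty C}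
    [A.IsStableUnderCobaseChange] [A.IsStableUnderComposition]
    {a b c d : C} {t : a ⟶ b} {l : a ⟶ c} {r : b ⟶ d} {u : c ⟶ d}
    (h : PushoutCorner A t l r u) (hl : A l) : A r := by
  obtain ⟨P, p, q, k, hP, hp, hq, hk⟩ := h
  rw [← hp]
  exact A.comp_mem _ _ (A.of_isPushout hP hl) hk

/-- A node component is its corner followed by a base change of the vertex component, so the
condition at a latching node is automatic. This makes the injective replacement usable for all three
structures. -/
lemma relFib_none_le {J : Type*} {C : Type*} [Category* C] (B : MorphismProperty C)
    [B.IsStableUnderBaseChange] [B.IsStableUnderComposition] (Λ : Option J) :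
    relFib B none ≤ relFib B Λ := fun _ _ _ h ↦
  ⟨h.vertex, fun j _ ↦ (h.matching j (by simp)).left h.vertex, fun j _ ↦ h.matching j (by simp)⟩

variable {M : Type*} [Category* M] [ModelCategory M]

/-- Two out of three, since the base change of `r` is again a trivial fibration. -/
lemma PullbackCorner.trivialFibration {a b c d : M} {t : a ⟶ b} {l : a ⟶ c} {r : b ⟶ d}
    {u : c ⟶ d} (h : PullbackCorner (fibrations M) t l r u) (hr : trivialFibrations M r)
    (hl : weakEquivalences M l) : PullbackCorner (trivialFibrations M) t l r u := by
  obtain ⟨P, p, q, k, hP, hp, hq, hk⟩ := h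
  exact ⟨P, p, q, k, hP, hp, hq, hk, (weakEquivalences M).of_postcomp k q
    ((trivialFibrations M).of_isPullback hP hr).2 (by rwa [hq])⟩

lemma PushoutCorner.trivialCofibration {a b c d : M} {t : a ⟶ b} {l : a ⟶ c} {r : b ⟶ d}
    {u : c ⟶ d} (h : PushoutCorner (cofibrations M) t l r u) (hl : trivialCofibrations M l)
    (hr : weakEquivalences M r) : PushoutCorner (trivialCofibrations M) t l r u := by
  obtain ⟨P, p, q, k, hP, hp, hq, hk⟩ := h
  exact ⟨P, p, q, k, hP, hp, hq, hk, (weakEquivalences M).of_precomp p k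
    ((trivialCofibrations M).of_isPushout hP hl).2 (by rwa [hp])⟩

variable {J : Type*} (M)

lemma relCof_inf_weakEquivalences (Λ : Option J) :
    relCof (cofibrations M) Λ ⊓ (weakEquivalences M).functorCategory (WidePullbackShape J) =
      relCof (trivialCofibrations M) Λ := by
  ext X Y f
  constructor
  · rintro ⟨h, hf⟩
    exact ⟨fun j ↦ ⟨h.node j, hf _⟩, fun hΛ ↦ ⟨h.vertex hΛ, hf _⟩,
      fun j hj ↦ (h.latching j hj).trivialCofibration ⟨h.node j, hf _⟩ (hf _)⟩
  · intro h
    refine ⟨⟨fun j ↦ (h.node j).1, fun hΛ ↦ (h.vertex hΛ).1,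
      fun j hj ↦ (h.latching j hj).mono (trivialCofibrations_sub_cofibrations M)⟩, ?_⟩
    rintro (_ | j)
    · cases hΛ : Λ with
      | none => exact (h.vertex hΛ).2
      | some j => exact ((h.latching j hΛ).right (h.node j)).2
    · exact (h.node j).2

lemma relFib_inf_weakEquivalences (Λ : Option J) :
    relFib (fibrations M) Λ ⊓ (weakEquivalences M).functorCategory (WidePullbackShape J) =
      relFib (trivialFibrations M) Λ := by
  ext X Y f
  constructor
  · rintro ⟨h, hf⟩
    exact ⟨⟨h.vertex, hf _⟩, fun j hj ↦ ⟨h.latching j hj, hf _⟩,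
      fun j hj ↦ (h.matching j hj).trivialFibration ⟨h.vertex, hf _⟩ (hf _)⟩
  · intro h
    refine ⟨⟨h.vertex.1, fun j hj ↦ (h.latching j hj).1,
      fun j hj ↦ (h.matching j hj).mono (trivialFibrations_sub_fibrations M)⟩, ?_⟩
    rintro (_ | j)
    · exact h.vertex.2
    · by_cases hj : Λ = some j
      · exact (h.latching j hj).2
      · exact ((h.matching j hj).left h.vertex).2

instance hasTwoOutOfThreeProperty_functorCategory {C : Type*} [Category* C]
    (W : MorphismProperty C) [W.HasTwoOutOfThreeProperty] (S : Type*) [Category* S] :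
    (W.functorCategory S).HasTwoOutOfThreeProperty where
  comp_mem _ _ hf hg s := W.comp_mem _ _ (hf s) (hg s)
  of_postcomp _ _ hg hfg s := W.of_postcomp _ _ (hg s) (hfg s)
  of_precomp _ _ hf hfg s := W.of_precomp _ _ (hf s) (hfg s)

/-- The classes of a model structure on wide cospans with objectwise weak equivalences, where
`Λ` is a set of at most one latching arm and the other arms are matching arms. -/
def wideCospanClasses (Λ : Option J) : MorphismClasses (WidePullbackShape J ⥤ M) where
  W := (weakEquivalences M).functorCategory _
  cof := relCof (cofibrations M) Λ
  fib := relFib (fibrations M) Λ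

lemma trivialCofibrations_isWeakFactorizationSystem [HasPullbacks M] [HasPushouts M]
    (Λ : Option J) : MorphismProperty.IsWeakFactorizationSystem
      ((wideCospanClasses M Λ).cof ⊓ (wideCospanClasses M Λ).W) (wideCospanClasses M Λ).fib := by
  change MorphismProperty.IsWeakFactorizationSystem
    (relCof (cofibrations M) Λ ⊓ (weakEquivalences M).functorCategory _) (relFib (fibrations M) Λ)
  rw [relCof_inf_weakEquivalences]
  exact isWeakFactorizationSystem_relCof_relFib _ _ _

lemma trivialFibrations_isWeakFactorizationSystem [HasPullbacks M] [HasPushouts M]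
    (Λ : Option J) : MorphismProperty.IsWeakFactorizationSystem
      (wideCospanClasses M Λ).cof ((wideCospanClasses M Λ).fib ⊓ (wideCospanClasses M Λ).W) := by
  change MorphismProperty.IsWeakFactorizationSystem
    (relCof (cofibrations M) Λ) (relFib (fibrations M) Λ ⊓ (weakEquivalences M).functorCategory _)
  rw [relFib_inf_weakEquivalences]
  exact isWeakFactorizationSystem_relCof_relFib _ _ _

end ModelStructure

/-- Three classes of maps of a complete and cocomplete category which satisfy the two out of three
property and define two functorial weak factorization systems are those of a model structure. -/
lemma MorphismClasses.IsModelStructure.mk' {C : Type u} [Category.{v} C] [HasLimits C]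
    [HasColimits C] (σ : MorphismClasses C) [σ.W.HasTwoOutOfThreeProperty]
    [h₁ : (σ.cof ⊓ σ.W).IsWeakFactorizationSystem σ.fib]
    [h₂ : σ.cof.IsWeakFactorizationSystem (σ.fib ⊓ σ.W)]
    [(σ.cof ⊓ σ.W).HasFunctorialFactorization σ.fib]
    [σ.cof.HasFunctorialFactorization (σ.fib ⊓ σ.W)] : σ.IsModelStructure where
  hasLimits := inferInstance
  hasColimits := inferInstance
  exists_modelCategory := by
    let : CategoryWithWeakEquivalences C := ⟨σ.W⟩
    let : CategoryWithCofibrations C := ⟨σ.cof⟩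
    let : CategoryWithFibrations C := ⟨σ.fib⟩
    have : (weakEquivalences C).HasTwoOutOfThreeProperty :=
      inferInstanceAs σ.W.HasTwoOutOfThreeProperty
    have : (trivialCofibrations C).IsWeakFactorizationSystem (fibrations C) := h₁
    have : (cofibrations C).IsWeakFactorizationSystem (trivialFibrations C) := h₂
    exact ⟨ModelCategory.mk' C, rfl, rfl, rfl⟩
  trivCof_fib := inferInstance
  cof_trivFib := inferInstance

lemma isModelStructure_wideCospanClasses {J : Type} (M : Type u) [Category.{v} M] [HasLimits M]
    [HasColimits M] [ModelCategory M]
    [MorphismProperty.HasFunctorialFactorization (trivialCofibrations M) (fibrations M)]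
    [MorphismProperty.HasFunctorialFactorization (cofibrations M) (trivialFibrations M)]
    (Λ : Option J) : (wideCospanClasses M Λ).IsModelStructure := by
  have := trivialCofibrations_isWeakFactorizationSystem M Λ
  have := trivialFibrations_isWeakFactorizationSystem M Λ
  have : (wideCospanClasses M Λ).W.HasTwoOutOfThreeProperty :=
    hasTwoOutOfThreeProperty_functorCategory _ _
  have : ((wideCospanClasses M Λ).cof ⊓ (wideCospanClasses M Λ).W).HasFunctorialFactorization
      (wideCospanClasses M Λ).fib := by
    change MorphismProperty.HasFunctorialFactorization
      (relCof (cofibrations M) Λ ⊓ (weakEquivalences M).functorCategory _) (relFib (fibrations M) Λ)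
    rw [relCof_inf_weakEquivalences]
    exact hasFunctorialFactorization_relCof_relFib _ _ _
  have : (wideCospanClasses M Λ).cof.HasFunctorialFactorization
      ((wideCospanClasses M Λ).fib ⊓ (wideCospanClasses M Λ).W) := by
    change (relCof (cofibrations M) Λ).HasFunctorialFactorization
      (relFib (fibrations M) Λ ⊓ (weakEquivalences M).functorCategory _)
    rw [relFib_inf_weakEquivalences]
    exact hasFunctorialFactorization_relCof_relFib _ _ _
  exact .mk' _

/-- The diagonal functor to wide cospans is a left Quillen functor. -/
lemma isQuillenAdjunction_wideCospanClasses {J : Type*} (M : Type*) [Category* M]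
    [ModelCategory M] (Λ : Option J) {G : (WidePullbackShape J ⥤ M) ⥤ M}
    (adj : Functor.const _ ⊣ G) :
    IsQuillenAdjunction (.ofModelCategory M) (wideCospanClasses M Λ) adj := by
  -- The arms of a constant diagram are identities, so the pushout corner is the identity of `Y`.
  have key {A : MorphismProperty M} [A.ContainsIdentities] {X Y : M} (f : X ⟶ Y) (hf : A f) :
      relCof A Λ ((Functor.const (WidePullbackShape J)).map f) :=
    ⟨fun _ ↦ hf, fun _ ↦ hf, fun _ _ ↦ ⟨Y, f, 𝟙 Y, 𝟙 Y, 
      show IsPushout (𝟙 X) f f (𝟙 Y) from .of_horiz_isIso ⟨by simp⟩,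
      Category.comp_id _, Category.comp_id _, A.id_mem Y⟩⟩
  exact ⟨fun f hf ↦ key f hf, fun f hf ↦ ⟨key f hf.1, fun _ ↦ hf.2⟩⟩

/-- A wide cospan of fibrant objects whose matching arms are fibrations is fibrant. -/
lemma fib_from_terminal {J : Type*} {M : Type*} [Category* M] [ModelCategory M] (Λ : Option J)
    {X T : WidePullbackShape J ⥤ M} (hT : ∀ i, IsTerminal (T.obj i)) (f : X ⟶ T)
    (hX : ∀ i, IsFibrant (X.obj i)) (hX' : ∀ j, Λ ≠ some j → Fibration (X.map (arm j))) :
    (wideCospanClasses M Λ).fib f := by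
  have h (i) : fibrations M (f.app i) := by
    rw [← fibration_iff, ← isFibrant_iff_of_isTerminal _ (hT i)]
    exact hX i
  -- The arms of `T` are isomorphisms, so the pullback is `X.obj none` and the corner map is the arm
  -- of `X` itself.
  exact ⟨h _, fun j _ ↦ h _, fun j hj ↦ ⟨X.obj none, 𝟙 _, (hT _).from _, X.map (arm j),
    by
      have : IsIso (T.map (arm j)) :=
        isIso_of_isTerminal (hT _) (hT _) _
      exact .of_horiz_isIso ⟨(hT _).hom_ext _ _⟩,
    Category.comp_id _, (hT _).hom_ext _ _, (hX' j hj).mem⟩⟩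

/-! ### Latching and matching categories of wide cospans -/

section LatchingMatching

lemma isIso_latchingMap_of_isEmpty {S : Type} [SmallCategory S] {M : Type u} [Category.{v} M]
    [HasColimits M] (P : MorphismProperty S) [P.IsMultiplicative] (r : S)
    [IsEmpty (LatchingCategory P r)] {X Y : S ⥤ M} (f : X ⟶ Y) : IsIso (latchingMap P r f) := by
  have : IsIso (Functor.whiskerLeft (latchingForget P r) f) :=
    (NatTrans.isIso_iff_isIso_app _).2 isEmptyElim
  exact ⟨colimMap (inv (Functor.whiskerLeft (latchingForget P r) f)),
    colimit.hom_ext isEmptyElim, colimit.hom_ext isEmptyElim⟩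

lemma isIso_matchingMap_of_isEmpty {S : Type} [SmallCategory S] {M : Type u} [Category.{v} M]
    [HasLimits M] (P : MorphismProperty S) [P.IsMultiplicative] (r : S)
    [IsEmpty (MatchingCategory P r)] {X Y : S ⥤ M} (f : X ⟶ Y) : IsIso (matchingMap P r f) := by
  have : IsIso (Functor.whiskerLeft (matchingForget P r) f) :=
    (NatTrans.isIso_iff_isIso_app _).2 isEmptyElim
  exact ⟨limMap (inv (Functor.whiskerLeft (matchingForget P r) f)),
    limit.hom_ext isEmptyElim, limit.hom_ext isEmptyElim⟩

lemma relLatching_iff_of_isEmpty {S : Type} [SmallCategory S] {M : Type u} [Category.{v} M]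
    [HasColimits M] (P : MorphismProperty S) [P.IsMultiplicative] (r : S)
    [IsEmpty (LatchingCategory P r)] (A : MorphismProperty M) [A.RespectsIso] {X Y : S ⥤ M}
    (f : X ⟶ Y) : A (relLatching P r f) ↔ A (f.app r) := by
  have := isIso_latchingMap_of_isEmpty P r f
  have h : pushout.inl _ _ ≫ relLatching P r f = f.app r := pushout.inl_desc _ _ _
  rw [← h, A.cancel_left_of_respectsIso]

lemma relMatching_iff_of_isEmpty {S : Type} [SmallCategory S] {M : Type u} [Category.{v} M]
    [HasLimits M] (P : MorphismProperty S) [P.IsMultiplicative] (r : S)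
    [IsEmpty (MatchingCategory P r)] (B : MorphismProperty M) [B.RespectsIso] {X Y : S ⥤ M}
    (f : X ⟶ Y) : B (relMatching P r f) ↔ B (f.app r) := by
  have := isIso_matchingMap_of_isEmpty P r f
  have h : relMatching P r f ≫ pullback.fst _ _ = f.app r := pullback.lift_fst _ _ _
  rw [← h, B.cancel_right_of_respectsIso]

variable {J : Type}

lemma isEmpty_latchingCategory_some (P : MorphismProperty (WidePullbackShape J))
    [P.IsMultiplicative] (j : J) : IsEmpty (LatchingCategory P (some j)) := by
  refine ⟨fun ⟨⟨⟨i, _, φ⟩, _⟩, h⟩ ↦ h ?_⟩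
  change WidePullbackShape.Hom i (some j) at φ
  cases φ
  exact ⟨_⟩

lemma isEmpty_matchingCategory_none (P : MorphismProperty (WidePullbackShape J))
    [P.IsMultiplicative] : IsEmpty (MatchingCategory P none) := by
  refine ⟨fun ⟨⟨⟨_, i, φ⟩, _⟩, h⟩ ↦ h ?_⟩
  change WidePullbackShape.Hom none i at φ
  cases φ
  exact ⟨_⟩

lemma isEmpty_matchingCategory_some (P : MorphismProperty (WidePullbackShape J))
    [P.IsMultiplicative] (j : J) (hj : ¬ P (arm j)) : IsEmpty (MatchingCategory P (some j)) := by
  refine ⟨fun ⟨⟨⟨_, i, φ⟩, hP⟩, h⟩ ↦ ?_⟩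
  change WidePullbackShape.Hom (some j) i at φ
  cases φ with
  | id => exact h ⟨_⟩
  | term => exact hj hP

lemma arm_not_identity (j : J) : ¬ MorphismProperty.identities _ (arm j) := by
  intro h
  cases h

/-- The object of the latching category of the vertex given by a latching arm. -/
def latchingArm (P : MorphismProperty (WidePullbackShape J)) [P.IsMultiplicative] (j : J)
    (hj : P (arm j)) : LatchingCategory P none :=
  ⟨MorphismProperty.Over.mk P (arm j) hj, arm_not_identity j⟩

/-- The object of the matching category of a node given by a matching arm. -/
def matchingArm (P : MorphismProperty (WidePullbackShape J)) [P.IsMultiplicative] (j : J)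
    (hj : P (arm j)) : MatchingCategory P (some j) :=
  ⟨MorphismProperty.Under.mk P (arm j) hj, arm_not_identity j⟩

/-- If there is only one latching arm, then it is the terminal object of the latching category. -/
def isTerminalLatchingArm (P : MorphismProperty (WidePullbackShape J)) [P.IsMultiplicative]
    (j : J) (hP : ∀ j', P (arm j') ↔ j' = j) :
    IsTerminal (latchingArm P j ((hP j).2 rfl)) :=
  have h (D : LatchingCategory P none) : D = latchingArm P j ((hP j).2 rfl) := by
    obtain ⟨⟨⟨i, ⟨⟨⟩⟩, φ⟩, hφ⟩, h⟩ := D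
    change WidePullbackShape.Hom i none at φ
    cases φ with
    | id => exact (h ⟨_⟩).elim
    | term j' =>
      obtain rfl := (hP j').1 hφ
      rfl
  .ofUniqueHom (fun D ↦ eqToHom (h D)) fun D φ ↦ by
    ext
    exact Subsingleton.elim _ _

/-- A matching arm is the initial object of the matching category. -/
def isInitialMatchingArm (P : MorphismProperty (WidePullbackShape J)) [P.IsMultiplicative]
    (j : J) (hj : P (arm j)) : IsInitial (matchingArm P j hj) :=
  have h (D : MatchingCategory P (some j)) : matchingArm P j hj = D := by
    obtain ⟨⟨⟨⟨⟨⟩⟩, i, φ⟩, hφ⟩, h⟩ := D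
    change WidePullbackShape.Hom (some j) i at φ
    cases φ with
    | id => exact (h ⟨_⟩).elim
    | term => rfl
  .ofUniqueHom (fun D ↦ eqToHom (h D)) fun D φ ↦ by
    ext
    exact Subsingleton.elim _ _

variable {M : Type u} [Category.{v} M]

/-- A terminal object of the latching category computes the colimit: the latching object at the
vertex is the value at the node `j`. -/
lemma relLatching_iff_pushoutCorner [HasColimits M] (P : MorphismProperty (WidePullbackShape J))
    [P.IsMultiplicative] (j : J) (hP : ∀ j', P (arm j') ↔ j' = j) (A : MorphismProperty M)
    [A.RespectsIso] {X Y : WidePullbackShape J ⥤ M} (f : X ⟶ Y) :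
    A (relLatching P none f) ↔
      PushoutCorner A (X.map (arm j)) (f.app (some j)) (f.app none) (Y.map (arm j)) := by
  let D := latchingArm P j ((hP j).2 rfl)
  let e (Z : WidePullbackShape J ⥤ M) : Z.obj (some j) ⟶ latchingObj P none Z :=
    colimit.ι (latchingForget P none ⋙ Z) D
  have he (Z : WidePullbackShape J ⥤ M) : IsIso (e Z) :=
    isIso_ι_of_isTerminal (isTerminalLatchingArm P j hP) _
  have h₁ (Z : WidePullbackShape J ⥤ M) : e Z ≫ latchingHom P none Z = Z.map (arm j) :=
    colimit.ι_desc _ _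
  have h₂ : e X ≫ latchingMap P none f = f.app (some j) ≫ e Y := ι_colimMap _ _
  have hQ := (IsPushout.of_hasPushout (latchingHom P none X) (latchingMap P none f)).of_iso
    (asIso (e X)).symm (Iso.refl _) (asIso (e Y)).symm (Iso.refl _)
    (f' := X.map (arm j)) (g' := f.app (some j)) (inl' := pushout.inl _ _)
    (inr' := e Y ≫ pushout.inr _ _) (by simp [← h₁]) (by simp [reassoc_of% h₂])
    (by simp) (by simp)
  refine (pushoutCorner_iff hQ ?_ ?_).symm
  · exact pushout.inl_desc _ _ _
  · rw [Category.assoc, ← h₁ Y]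
    exact congrArg _ (pushout.inr_desc _ _ _)

lemma relMatching_iff_pullbackCorner [HasLimits M] (P : MorphismProperty (WidePullbackShape J))
    [P.IsMultiplicative] (j : J) (hj : P (arm j)) (B : MorphismProperty M)
    [B.RespectsIso] {X Y : WidePullbackShape J ⥤ M} (f : X ⟶ Y) :
    B (relMatching P (some j) f) ↔
      PullbackCorner B (X.map (arm j)) (f.app (some j)) (f.app none) (Y.map (arm j)) := by
  let D := matchingArm P j hj
  let e (Z : WidePullbackShape J ⥤ M) : matchingObj P (some j) Z ⟶ Z.obj none :=
    limit.π (matchingForget P (some j) ⋙ Z) D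
  have he (Z : WidePullbackShape J ⥤ M) : IsIso (e Z) :=
    isIso_π_of_isInitial (isInitialMatchingArm P j hj) _
  have h₁ (Z : WidePullbackShape J ⥤ M) : matchingHom P (some j) Z ≫ e Z = Z.map (arm j) :=
    limit.lift_π _ _
  have h₂ : matchingMap P (some j) f ≫ e Y = e X ≫ f.app none := limMap_π _ _
  have hQ := (IsPullback.of_hasPullback (matchingHom P (some j) Y)
    (matchingMap P (some j) f)).of_iso (Iso.refl _) (Iso.refl _) (asIso (e X)) (asIso (e Y))
    (fst' := pullback.fst _ _) (snd' := pullback.snd _ _ ≫ e X)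
    (f' := Y.map (arm j)) (g' := f.app none) (by simp) (by simp) (by simp [← h₁])
    (by simp [← h₂])
  refine (pullbackCorner_iff hQ.flip ?_ ?_).symm
  · rw [← h₁ X, ← Category.assoc]
    exact congrArg (· ≫ e X) (pullback.lift_snd _ _ _)
  · exact pullback.lift_fst _ _ _

end LatchingMatching

/-! ### Comparison with the injective and the Reedy classes -/

section Comparison

/-- Only the direction of each arm matters: latching categories of nodes, and the matching
categories of the vertex and of `j₀`, are empty; the remaining ones have a single object. -/
lemma reedyClasses_eq (M : Type u) [Category.{v} M] [HasLimits M] [HasColimits M]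
    [ModelCategory M] {J : Type} {W₁ W₂ : MorphismProperty (WidePullbackShape J)}
    [W₁.IsMultiplicative] [W₂.IsMultiplicative] (ρ : ReedyStructure W₁ W₂ ℕ) (j₀ : J)
    (h₁ : ∀ j, W₁ (arm j) ↔ j ≠ j₀) (h₂ : ∀ j, W₂ (arm j) ↔ j = j₀) :
    reedyClasses M ρ = wideCospanClasses M (some j₀) := by
  have hcof : (reedyClasses M ρ).cof = relCof (cofibrations M) (some j₀) := by
    ext X Y f
    have := isEmpty_latchingCategory_some W₂
    change (∀ r, Cofibration (relLatching W₂ r f)) ↔ IsRelCof _ _ f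
    simp only [cofibration_iff]
    constructor
    · intro h
      refine ⟨fun j ↦ (relLatching_iff_of_isEmpty _ _ _ f).1 (h (some j)), by simp, ?_⟩
      rintro j hj
      obtain rfl := Option.some_injective _ hj
      exact (relLatching_iff_pushoutCorner _ _ h₂ _ f).1 (h none)
    · rintro h (_ | j)
      · exact (relLatching_iff_pushoutCorner _ _ h₂ _ f).2 (h.latching j₀ rfl)
      · exact (relLatching_iff_of_isEmpty _ _ _ f).2 (h.node j)
  have hfib : (reedyClasses M ρ).fib = relFib (fibrations M) (some j₀) := by
    ext X Y f
    have := isEmpty_matchingCategory_none W₁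
    have := isEmpty_matchingCategory_some W₁ j₀ (by simp [h₁])
    change (∀ r, Fibration (relMatching W₁ r f)) ↔ IsRelFib _ _ f
    simp only [fibration_iff]
    constructor
    · intro h
      refine ⟨(relMatching_iff_of_isEmpty _ _ _ f).1 (h none), fun j hj ↦ ?_, fun j hj ↦ ?_⟩
      · obtain rfl := Option.some_injective _ hj
        exact (relMatching_iff_of_isEmpty _ _ _ f).1 (h (some j₀))
      · exact (relMatching_iff_pullbackCorner _ _ ((h₁ j).2 (by grind)) _ f).1 (h (some j))
    · rintro h (_ | j)
      · exact (relMatching_iff_of_isEmpty _ _ _ f).2 h.vertex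
      · by_cases hj : j = j₀
        · subst hj
          exact (relMatching_iff_of_isEmpty _ _ _ f).2 (h.latching j rfl)
        · exact (relMatching_iff_pullbackCorner _ _ ((h₁ j).2 hj) _ f).2
            (h.matching j (by grind))
  have hW : (reedyClasses M ρ).W = (weakEquivalences M).functorCategory _ := rfl
  generalize reedyClasses M ρ = σ at *
  obtain ⟨W, cof, fib⟩ := σ
  subst hcof hfib hW
  rfl

/-- Injective fibrations are defined by lifting; the weak factorization system turns this into the
explicit corner description. -/
lemma injectiveClasses_eq (M : Type u) [Category.{v} M] [ModelCategory M] [HasPullbacks M]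
    [HasPushouts M] (J : Type) :
    injectiveClasses (WidePullbackShape J) M = wideCospanClasses M none := by
  have hcof : (cofibrations M).functorCategory (WidePullbackShape J) =
      relCof (cofibrations M) none := by
    ext X Y f
    exact ⟨fun h ↦ ⟨fun j ↦ h _, fun _ ↦ h _, by simp⟩,
      fun h i ↦ i.casesOn (h.vertex rfl) h.node⟩
  have := trivialCofibrations_isWeakFactorizationSystem (J := J) M none
  have hfib := MorphismProperty.rlp_eq_of_wfs
    ((wideCospanClasses (J := J) M none).cof ⊓ (wideCospanClasses M none).W)
    (wideCospanClasses M none).fib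
  unfold injectiveClasses
  rw [hcof]
  exact congrArg (MorphismClasses.mk _ _) hfib

/-- The latching arm of each of the three structures. -/
def CospanStructure.latchingArm : CospanStructure → Option WalkingPair
  | .inj => none
  | .reedyI => some .left
  | .reedyD => some .right

lemma cospanClasses_eq (M : Type u) [Category.{v} M] [HasLimits M] [HasColimits M]
    [ModelCategory M] (σ : CospanStructure) :
    cospanClasses M σ = wideCospanClasses M σ.latchingArm := by
  cases σ
  · exact injectiveClasses_eq M _
  · refine reedyClasses_eq M (cospanReedy _ degIncreasing_injective) _ ?_ ?_ <;>
      rintro (_ | _) <;> simp [degMinus, degPlus, degIncreasing]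
  · refine reedyClasses_eq M (cospanReedy _ degDecreasing_injective) _ ?_ ?_ <;>
      rintro (_ | _) <;> simp [degMinus, degPlus, degDecreasing]

end Comparison

/-! ### Right derived functors of right Quillen functors -/

section Derived

lemma MorphismClasses.IsModelStructure.exists_eq {C : Type u} [Category.{v} C]
    {σ : MorphismClasses C} (hσ : σ.IsModelStructure) :
    ∃ m : ModelCategory C, σ = @MorphismClasses.ofModelCategory C _ m := by
  obtain ⟨m, h₁, h₂, h₃⟩ := hσ.exists_modelCategory
  refine ⟨m, ?_⟩
  obtain ⟨W, cof, fib⟩ := σ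
  subst h₁ h₂ h₃
  rfl

lemma MorphismClasses.IsModelStructure.hasTwoOutOfThreeProperty {C : Type u} [Category.{v} C]
    {σ : MorphismClasses C} (hσ : σ.IsModelStructure) : σ.W.HasTwoOutOfThreeProperty := by
  obtain ⟨m, rfl⟩ := hσ.exists_eq
  exact m.cm2

namespace IsQuillenAdjunction

variable {C M : Type*} [Category* C] [Category* M] [ModelCategory M] [ModelCategory C]
  {F : M ⥤ C} {G : C ⥤ M} {adj : F ⊣ G}
  (hQ : IsQuillenAdjunction (.ofModelCategory M) (.ofModelCategory C) adj)

include hQ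

lemma trivialFibrations_map {X Y : C} (f : X ⟶ Y) (hf : trivialFibrations C f) :
    trivialFibrations M (G.map f) := by
  rw [← cofibrations_rlp]
  intro A B i hi
  rw [← adj.hasLiftingProperty_iff]
  exact MorphismProperty.hasLiftingProperty_of_wfs _ _
    (show cofibrations C (F.map i) from hQ.cof i hi) hf

/-- Ken Brown's lemma for right Quillen functors. -/
lemma weakEquivalences_map {X Y : C} (f : X ⟶ Y) [IsFibrant X] [IsFibrant Y]
    [WeakEquivalence f] : weakEquivalences M (G.map f) := by
  -- Here `f = i ≫ p` with `r` a retraction of `i`, and `r`, `p` are trivial fibrations, which `G`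
  -- preserves.
  let h : FibrantBrownFactorization f := Classical.arbitrary _
  have : Fibration h.p := ⟨h.hp⟩
  have hr := (hQ.trivialFibrations_map h.r (mem_trivialFibrations _)).2
  have hp := (hQ.trivialFibrations_map h.p (mem_trivialFibrations _)).2
  have hi : weakEquivalences M (G.map h.i) := by
    refine (weakEquivalences M).of_postcomp _ _ hr ?_
    rw [← G.map_comp, h.i_r, G.map_id]
    exact (weakEquivalences M).id_mem _
  rw [← h.fac, G.map_comp]
  exact (weakEquivalences M).comp_mem _ _ hi hp

end IsQuillenAdjunction

variable {C : Type u} [Category.{v} C] [HasTerminal C] {M : Type u₁} [Category.{v₁} M]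
  [ModelCategory M] {σ τ : MorphismClasses C} {F : M ⥤ C} {G : C ⥤ M} {adj : F ⊣ G}

lemma weakEquivalences_map_of_fibrant (hσ : σ.IsModelStructure)
    (hQ : IsQuillenAdjunction (.ofModelCategory M) σ adj) {X Y : C} {f : X ⟶ Y} (hf : σ.W f)
    (hX : σ.fib (terminal.from X)) (hY : σ.fib (terminal.from Y)) :
    weakEquivalences M (G.map f) := by
  obtain ⟨m, rfl⟩ := hσ.exists_eq
  have : IsFibrant X := (isFibrant_iff X).2 ⟨hX⟩
  have : IsFibrant Y := (isFibrant_iff Y).2 ⟨hY⟩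
  have : WeakEquivalence f := ⟨hf⟩
  exact hQ.weakEquivalences_map f

lemma FibrantCReplacement.map_mem (hσ : σ.IsModelStructure) (R : FibrantCReplacement σ) {X Y : C}
    {f : X ⟶ Y} (hf : σ.W f) : σ.W (R.R.map f) := by
  have := hσ.hasTwoOutOfThreeProperty
  refine σ.W.of_precomp (R.r.app X) _ (R.trivCof X).2 ?_
  rw [← R.r.naturality]
  exact σ.W.comp_mem _ _ hf (R.trivCof Y).2

variable {H : Type*} [Category* H] (L : M ⥤ H) [L.IsLocalization (weakEquivalences M)]

lemma FibrantCReplacement.isInvertedBy (hσ : σ.IsModelStructure)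
    (hQ : IsQuillenAdjunction (.ofModelCategory M) σ adj) (R : FibrantCReplacement σ) :
    σ.W.IsInvertedBy (R.R ⋙ G ⋙ L) := fun _ _ _ hf ↦
  Localization.inverts L (weakEquivalences M) _
    (weakEquivalences_map_of_fibrant hσ hQ (R.map_mem hσ hf) (R.fibrant _) (R.fibrant _))

/-- Both replacements map to the double one, by `R X ⟶ R' (R X) ⟵ R' X`. All three objects are
`σ`-fibrant, so Ken Brown's lemma for `σ` alone suffices. -/
lemma FibrantCReplacement.nonempty_iso (hσ : σ.IsModelStructure)
    (hQ : IsQuillenAdjunction (.ofModelCategory M) σ adj) (hτ : τ.IsModelStructure)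
    (hW : τ.W = σ.W) (hfib : τ.fib ≤ σ.fib)
    (R : FibrantCReplacement σ) (R' : FibrantCReplacement τ) :
    Nonempty (R.R ⋙ G ⋙ L ≅ R'.R ⋙ G ⋙ L) := by
  let a : R.R ⋙ G ⋙ L ⟶ R.R ⋙ R'.R ⋙ G ⋙ L :=
    Functor.whiskerLeft R.R (Functor.whiskerRight R'.r (G ⋙ L))
  let b : R'.R ⋙ G ⋙ L ⟶ R.R ⋙ R'.R ⋙ G ⋙ L :=
    Functor.whiskerRight R.r (R'.R ⋙ G ⋙ L)
  have ha : IsIso a := by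
    rw [NatTrans.isIso_iff_isIso_app]
    intro X
    exact Localization.inverts L (weakEquivalences M) _ (weakEquivalences_map_of_fibrant hσ hQ
      (f := R'.r.app (R.R.obj X)) (by rw [← hW]; exact (R'.trivCof _).2) (R.fibrant _)
      (hfib _ (R'.fibrant _)))
  have hb : IsIso b := by
    rw [NatTrans.isIso_iff_isIso_app]
    intro X
    exact Localization.inverts L (weakEquivalences M) _ (weakEquivalences_map_of_fibrant hσ hQ
      (f := R'.R.map (R.r.app X))
      (by rw [← hW]; exact R'.map_mem hτ (by rw [hW]; exact (R.trivCof _).2))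
      (hfib _ (R'.fibrant _)) (hfib _ (R'.fibrant _)))
  exact ⟨asIso a ≪≫ (asIso b).symm⟩

variable {HC : Type*} [Category* HC] (LC : C ⥤ HC) [LC.IsLocalization σ.W]

/-- By Ken Brown's lemma `G ⋙ L` inverts weak equivalences between fibrant objects, so the Kan
extension property can be tested on the unit at fibrant objects. -/
lemma isRightDerivedFunctor_of_isIso (hσ : σ.IsModelStructure)
    (hQ : IsQuillenAdjunction (.ofModelCategory M) σ adj) {RG : HC ⥤ H} (α : G ⋙ L ⟶ LC ⋙ RG)
    (hα : ∀ X, σ.fib (terminal.from X) → IsIso (α.app X)) : RG.IsRightDerivedFunctor α σ.W := by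
  obtain ⟨m, rfl⟩ := hσ.exists_eq
  have h : (FibrantObject.localizerMorphism C).Derives (G ⋙ L) := fun X Y f hf ↦
    Localization.inverts L (weakEquivalences M) _ <| by
      have : WeakEquivalence ((FibrantObject.localizerMorphism C).functor.map f) := ⟨hf⟩
      have (Z : FibrantObject C) :
        IsFibrant ((FibrantObject.localizerMorphism C).functor.obj Z) := Z.2
      exact hQ.weakEquivalences_map _
  have : LC.IsLocalization (weakEquivalences C) :=
    inferInstanceAs (LC.IsLocalization (MorphismClasses.ofModelCategory C).W)
  exact h.isRightDerivedFunctor_of_isIso α fun X ↦ hα _ ((isFibrant_iff X.obj).1 X.2).mem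

lemma FibrantCReplacement.exists_isRightDerivedFunctor (hσ : σ.IsModelStructure)
    (hQ : IsQuillenAdjunction (.ofModelCategory M) σ adj) (R : FibrantCReplacement σ) :
    ∃ (RG : HC ⥤ H) (α : G ⋙ L ⟶ LC ⋙ RG), RG.IsRightDerivedFunctor α σ.W ∧
      Nonempty (R.R ⋙ G ⋙ L ≅ LC ⋙ RG) := by
  have hR := R.isInvertedBy L hσ hQ
  let e : LC ⋙ Localization.lift _ hR LC ≅ R.R ⋙ G ⋙ L := Localization.fac _ hR LC
  refine ⟨_, Functor.whiskerRight R.r (G ⋙ L) ≫ e.inv,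
    isRightDerivedFunctor_of_isIso L LC hσ hQ _ fun X hX ↦ ?_, ⟨e.symm⟩⟩
  have : IsIso ((Functor.whiskerRight R.r (G ⋙ L)).app X) :=
    Localization.inverts L (weakEquivalences M) _
      (weakEquivalences_map_of_fibrant hσ hQ (R.trivCof X).2 hX (R.fibrant X))
  rw [NatTrans.comp_app]
  infer_instance

lemma exists_isRightDerived (hσ : σ.IsModelStructure)
    (hQ : IsQuillenAdjunction (.ofModelCategory M) σ adj) (κ : DerivedKind) :
    ∃ RG : HC ⥤ H, IsRightDerived σ LC L G RG κ := by
  have := hσ.trivCof_fib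
  let R : FibrantCReplacement σ := .ofFactorization
    (MorphismProperty.functorialFactorizationData _ _)
  obtain ⟨RG, α, h, h'⟩ := R.exists_isRightDerivedFunctor L LC hσ hQ
  cases κ
  · exact ⟨RG, α, h⟩
  · exact ⟨RG, R, h'⟩

variable {L LC} in
/-- A right derived functor of any of the two kinds is computed by any fibrant C-replacement
functor. -/
lemma IsRightDerived.nonempty_iso (hσ : σ.IsModelStructure)
    (hQ : IsQuillenAdjunction (.ofModelCategory M) σ adj) {κ : DerivedKind} {RG : HC ⥤ H}
    (h : IsRightDerived σ LC L G RG κ) (R : FibrantCReplacement σ) :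
    Nonempty (LC ⋙ RG ≅ R.R ⋙ G ⋙ L) := by
  cases κ with
  | kan =>
    obtain ⟨α, hα⟩ := h
    obtain ⟨RG', α', hα', ⟨e⟩⟩ := R.exists_isRightDerivedFunctor L LC hσ hQ
    exact ⟨Functor.isoWhiskerLeft LC (Functor.rightDerivedUnique RG RG' α α' σ.W) ≪≫ e.symm⟩
  | strong =>
    obtain ⟨R', ⟨e⟩⟩ := h
    obtain ⟨e'⟩ := R'.nonempty_iso L hσ hQ hσ rfl le_rfl R
    exact ⟨e.symm ≪≫ e'⟩

end Derived

/-! ### Isomorphisms in the homotopy category -/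

section Whitehead

variable {M : Type*} [Category* M] [ModelCategory M] {H : Type*} [Category* H] (L : M ⥤ H)
  [L.IsLocalization (weakEquivalences M)]

lemma isIso_map_of_weakEquivalence {X Y : M} (f : X ⟶ Y) [WeakEquivalence f] : IsIso (L.map f) :=
  Localization.inverts L (weakEquivalences M) f WeakEquivalence.mem

/-- A fibration between bifibrant objects which becomes an isomorphism in the homotopy category
is a weak equivalence. -/
lemma weakEquivalence_of_fibration_of_isIso_map {X Y : M} [IsCofibrant X] [IsFibrant X]
    [IsCofibrant Y] [IsFibrant Y] (p : X ⟶ Y) [Fibration p] [IsIso (L.map p)] :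
    WeakEquivalence p := by
  obtain ⟨g, hg⟩ := map_surjective_of_isLocalization L Y X (inv (L.map p))
  have h : LeftHomotopyRel (g ≫ p) (𝟙 Y) := by
    rw [LeftHomotopyRel.iff_map_eq L]
    simp [hg]
  obtain ⟨P, _, ⟨h⟩⟩ := h.exists_good_cylinder
  -- Lifting the homotopy from `g ≫ p` to the identity along `p` deforms `g` into a strict section
  -- `s`.
  have sq : CommSq g P.i₀ p h.h := ⟨by simp⟩
  let s : Y ⟶ X := P.i₁ ≫ sq.lift
  have hs : s ≫ p = 𝟙 Y := by simp [s]
  have hs' : L.map s = inv (L.map p) := by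
    rw [← cancel_mono (L.map p), ← L.map_comp, hs]
    simp
  have h' : LeftHomotopyRel (𝟙 X) (p ≫ s) := by
    rw [LeftHomotopyRel.iff_map_eq L]
    simp [hs']
  obtain ⟨Q, ⟨h'⟩⟩ := h'
  have hps : WeakEquivalence (p ≫ s) := h'.weakEquivalence_iff.1 inferInstance
  rw [weakEquivalence_iff] at hps ⊢
  -- Since `s` is a section of `p`, the map `p` is a retract of `p ≫ s`, which is homotopic to the
  -- identity.
  let ρ : RetractArrow p (p ≫ s) :=
    { i := Arrow.homMk (𝟙 X) s (by simp)
      r := Arrow.homMk (𝟙 X) p (by simp [hs])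
      retract := by
        ext
        · exact Category.comp_id _
        · exact hs }
  exact (weakEquivalences M).of_retract ρ hps

/-- A map between bifibrant objects which becomes an isomorphism in the homotopy category
is a weak equivalence. -/
lemma weakEquivalence_of_isIso_map {X Y : M} [IsCofibrant X] [IsFibrant X]
    [IsCofibrant Y] [IsFibrant Y] (f : X ⟶ Y) [IsIso (L.map f)] : WeakEquivalence f := by
  let F := MorphismProperty.factorizationData (trivialCofibrations M) (fibrations M) f
  have : Cofibration F.i := ⟨F.hi.1⟩
  have : WeakEquivalence F.i := ⟨F.hi.2⟩
  have : Fibration F.p := ⟨F.hp⟩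
  have : IsCofibrant F.Z := isCofibrant_of_cofibration F.i
  have : IsFibrant F.Z := isFibrant_of_fibration F.p
  have := isIso_map_of_weakEquivalence L F.i
  have : IsIso (L.map F.i ≫ L.map F.p) := by
    rw [← L.map_comp, F.fac]
    infer_instance
  have : IsIso (L.map F.p) := IsIso.of_isIso_comp_left (L.map F.i) _
  have := weakEquivalence_of_fibration_of_isIso_map L F.p
  rw [← F.fac]
  infer_instance

lemma exists_bifibrant (A : M) : ∃ (B B' : M) (p : B ⟶ A) (i : B ⟶ B'), WeakEquivalence p ∧
    WeakEquivalence i ∧ IsCofibrant B' ∧ IsFibrant B' := by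
  let F := MorphismProperty.factorizationData (cofibrations M) (trivialFibrations M)
    (initial.to A)
  let F' := MorphismProperty.factorizationData (trivialCofibrations M) (fibrations M)
    (terminal.from F.Z)
  have : Cofibration F'.i := ⟨F'.hi.1⟩
  have : IsCofibrant F.Z := (isCofibrant_iff_of_isInitial F.i initialIsInitial).2 ⟨F.hi⟩
  exact ⟨F.Z, F'.Z, F.p, F'.i, ⟨F.hp.2⟩, ⟨F'.hi.2⟩, isCofibrant_of_cofibration F'.i,
    (isFibrant_iff_of_isTerminal F'.p terminalIsTerminal).2 ⟨F'.hp⟩⟩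

lemma WeqZigzag.nonempty_iso {A B : M} (h : WeqZigzag A B) : Nonempty (L.obj A ≅ L.obj B) := by
  induction h with
  | rel _ _ h =>
    obtain ⟨f, _⟩ := h
    have := isIso_map_of_weakEquivalence L f
    exact ⟨asIso (L.map f)⟩
  | refl => exact ⟨Iso.refl _⟩
  | symm _ _ _ h => exact ⟨h.some.symm⟩
  | trans _ _ _ _ _ h h' => exact ⟨h.some ≪≫ h'.some⟩

/-- Between bifibrant replacements the isomorphism is represented by an actual map, which is then a
weak equivalence. -/
lemma weqZigzag_iff_nonempty_iso (A B : M) : WeqZigzag A B ↔ Nonempty (L.obj A ≅ L.obj B) := by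
  refine ⟨WeqZigzag.nonempty_iso L, fun ⟨e⟩ ↦ ?_⟩
  obtain ⟨A₁, A₂, p, i, _, _, _, _⟩ := exists_bifibrant A
  obtain ⟨B₁, B₂, q, j, _, _, _, _⟩ := exists_bifibrant B
  have hA : WeqZigzag A A₂ := .trans _ _ _ (.symm _ _ (.rel _ _ ⟨p, ‹_›⟩)) (.rel _ _ ⟨i, ‹_›⟩)
  have hB : WeqZigzag B B₂ := .trans _ _ _ (.symm _ _ (.rel _ _ ⟨q, ‹_›⟩)) (.rel _ _ ⟨j, ‹_›⟩)
  obtain ⟨eA⟩ := hA.nonempty_iso L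
  obtain ⟨eB⟩ := hB.nonempty_iso L
  obtain ⟨f, hf⟩ := map_surjective_of_isLocalization L A₂ B₂ (eA.symm ≪≫ e ≪≫ eB).hom
  have : IsIso (L.map f) := by
    rw [hf]
    infer_instance
  have := weakEquivalence_of_isIso_map L f
  exact .trans _ _ _ (.trans _ _ _ hA (.rel _ _ ⟨f, this⟩)) (.symm _ _ hB)

end Whitehead

/-! ### Homotopy pullbacks -/

section HomotopyPullback

variable (M : Type u) [Category.{v} M] [HasLimits M] [HasColimits M] [ModelCategory M]

lemma cospanClasses_W (σ : CospanStructure) :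
    (cospanClasses M σ).W = (weakEquivalences M).functorCategory WalkingCospan := by
  rw [cospanClasses_eq]
  rfl

lemma cospanClasses_inj_fib_le (σ : CospanStructure) :
    (cospanClasses M .inj).fib ≤ (cospanClasses M σ).fib := by
  rw [cospanClasses_eq, cospanClasses_eq]
  exact relFib_none_le _ _

lemma isQuillenAdjunction_cospanClasses (σ : CospanStructure) :
    IsQuillenAdjunction (.ofModelCategory M) (cospanClasses M σ)
      (constLimAdj (J := WalkingCospan) (C := M)) := by
  rw [cospanClasses_eq]
  exact isQuillenAdjunction_wideCospanClasses M _ _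

variable {M} in
/-- A cospan of fibrant objects with at least one fibration is fibrant for one of the structures. -/
lemma exists_fib_cospan {C D B : M} (g : C ⟶ D) (h : B ⟶ D) [IsFibrant C] [IsFibrant D]
    [IsFibrant B] (hgh : Fibration g ∨ Fibration h) :
    ∃ σ, (cospanClasses M σ).fib (terminal.from (cospan g h)) := by
  have hT (i) : IsTerminal ((⊤_ (WalkingCospan ⥤ M)).obj i) :=
    terminalIsTerminal.isTerminalObj ((evaluation _ _).obj i) _
  have hX : ∀ i, IsFibrant ((cospan g h).obj i) := by
    rintro (_ | _ | _)
    all_goals assumption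
  rcases hgh with hg | hh
  · refine ⟨.reedyD, ?_⟩
    rw [cospanClasses_eq]
    refine fib_from_terminal _ hT _ hX ?_
    rintro (_ | _) hj
    · exact hg
    · exact (hj rfl).elim
  · refine ⟨.reedyI, ?_⟩
    rw [cospanClasses_eq]
    refine fib_from_terminal _ hT _ hX ?_
    rintro (_ | _) hj
    · exact (hj rfl).elim
    · exact hh

variable [MorphismProperty.HasFunctorialFactorization (trivialCofibrations M) (fibrations M)]
  [MorphismProperty.HasFunctorialFactorization (cofibrations M) (trivialFibrations M)]

lemma isModelStructure_cospanClasses (σ : CospanStructure) :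
    (cospanClasses M σ).IsModelStructure := by
  rw [cospanClasses_eq]
  exact isModelStructure_wideCospanClasses M _

/-- A fibrant C-replacement functor for the injective structure on cospans. -/
def injectiveReplacement : FibrantCReplacement (cospanClasses M .inj) :=
  have := (isModelStructure_cospanClasses M .inj).trivCof_fib
  .ofFactorization (MorphismProperty.functorialFactorizationData _ _)

variable {M} {H : Type*} [Category* H] (L : M ⥤ H) [L.IsLocalization (weakEquivalences M)]
  {HC : Type*} [Category* HC]

lemma IsHomotopyLimit.nonempty_iso {κ : DerivedKind} {σ : CospanStructure} {L : M ⥤ H}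
    [L.IsLocalization (weakEquivalences M)] {LC : (WalkingCospan ⥤ M) ⥤ HC}
    [LC.IsLocalization (cospanClasses M σ).W] {F : HC ⥤ H} (h : IsHomotopyLimit κ σ L LC F) :
    Nonempty (LC ⋙ F ≅ (injectiveReplacement M).R ⋙ lim ⋙ L) := by
  have hσ := isModelStructure_cospanClasses M σ
  have hQ := isQuillenAdjunction_cospanClasses M σ
  have := hσ.trivCof_fib
  let R : FibrantCReplacement (cospanClasses M σ) := .ofFactorization
    (MorphismProperty.functorialFactorizationData _ _)
  obtain ⟨e⟩ := IsRightDerived.nonempty_iso hσ hQ h R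
  obtain ⟨e'⟩ := R.nonempty_iso L hσ hQ (isModelStructure_cospanClasses M .inj)
    ((cospanClasses_W M _).trans (cospanClasses_W M _).symm) (cospanClasses_inj_fib_le M σ)
    (injectiveReplacement M)
  exact ⟨e ≪≫ e'⟩

/-- The right-hand side mentions neither `κ` nor `σ`; this is the source of the independence for
objects. -/
lemma isHomotopyPullback_iff (κ : DerivedKind) (σ : CospanStructure)
    (LC : (WalkingCospan ⥤ M) ⥤ HC) [LC.IsLocalization (cospanClasses M σ).W]
    (X : WalkingCospan ⥤ M) (A : M) :
    IsHomotopyPullback κ σ L LC X A ↔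
      WeqZigzag A (lim.obj ((injectiveReplacement M).R.obj X)) := by
  rw [weqZigzag_iff_nonempty_iso L]
  constructor
  · rintro ⟨F, hF, ⟨e⟩⟩
    exact ⟨e ≪≫ hF.nonempty_iso.some.app X⟩
  · rintro ⟨e⟩
    obtain ⟨F, hF⟩ := exists_isRightDerived L LC (isModelStructure_cospanClasses M σ)
      (isQuillenAdjunction_cospanClasses M σ) κ
    exact ⟨F, hF, ⟨e ≪≫ ((IsHomotopyLimit.nonempty_iso hF).some.app X).symm⟩⟩

/-- The homotopy pullback of a cospan is the limit of any objectwise weakly equivalent cospan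
which is fibrant for one of the structures. -/
lemma weqZigzag_lim_of_fibrant (σ : CospanStructure) {X Y : WalkingCospan ⥤ M} (f : X ⟶ Y)
    (hf : (cospanClasses M σ).W f) (hY : (cospanClasses M σ).fib (terminal.from Y)) :
    WeqZigzag (lim.obj ((injectiveReplacement M).R.obj X)) (lim.obj Y) := by
  let R := injectiveReplacement M
  have hσ := isModelStructure_cospanClasses M σ
  have hQ := isQuillenAdjunction_cospanClasses M σ
  have hi := isModelStructure_cospanClasses M .inj
  have hW : (cospanClasses M .inj).W = (cospanClasses M σ).W :=
    (cospanClasses_W M _).trans (cospanClasses_W M _).symm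
  have hR (Z) : (cospanClasses M σ).fib (terminal.from (R.R.obj Z)) :=
    cospanClasses_inj_fib_le M σ _ (R.fibrant Z)
  -- The zigzag is `lim (R X) ⟶ lim (R Y) ⟵ lim Y`, with all three cospans `σ`-fibrant.
  refine .trans _ (lim.obj (R.R.obj Y)) _ (.rel _ _ ⟨lim.map (R.R.map f), ⟨?_⟩⟩)
    (.symm _ _ (.rel _ _ ⟨lim.map (R.r.app Y), ⟨?_⟩⟩))
  · exact weakEquivalences_map_of_fibrant hσ hQ (by rw [← hW] at hf ⊢; exact R.map_mem hi hf)
      (hR X) (hR Y)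
  · exact weakEquivalences_map_of_fibrant hσ hQ (by rw [← hW]; exact (R.trivCof Y).2) hY (hR Y)

end HomotopyPullback

end HoPullback

end

theorem mainTheorem1
    -- a model category with functorial factorizations
    {M : Type u} [Category.{v} M] [HasLimits M] [HasColimits M] [ModelCategory M]
    [MorphismProperty.HasFunctorialFactorization (trivialCofibrations M) (fibrations M)]
    [MorphismProperty.HasFunctorialFactorization (cofibrations M) (trivialFibrations M)]
    -- its homotopy category, and those of its category of cospans
    {H : Type u₁} [Category.{v₁} H] (L : M ⥤ H) [L.IsLocalization (weakEquivalences M)]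
    {HC : HoPullback.CospanStructure → Type u₂} [∀ σ, Category.{v₂} (HC σ)]
    (LC : ∀ σ, (WalkingCospan ⥤ M) ⥤ HC σ)
    [∀ σ, (LC σ).IsLocalization (HoPullback.cospanClasses M σ).W] :
    -- the three model structures exist and the pullback functor is right Quillen
    (∀ σ, (HoPullback.cospanClasses M σ).IsModelStructure ∧
      HoPullback.IsQuillenAdjunction (HoPullback.MorphismClasses.ofModelCategory M)
        (HoPullback.cospanClasses M σ) (constLimAdj (J := WalkingCospan) (C := M))) ∧
    -- the homotopy pullback functors of both types exist
    (∀ κ σ, ∃ F : HC σ ⥤ H, HoPullback.IsHomotopyLimit κ σ L (LC σ) F) ∧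
    -- and are independent of the type and of the model structure
    (∀ κ σ κ' σ' (F : HC σ ⥤ H) (F' : HC σ' ⥤ H),
      HoPullback.IsHomotopyLimit κ σ L (LC σ) F →
      HoPullback.IsHomotopyLimit κ' σ' L (LC σ') F' →
      Nonempty (LC σ ⋙ F ≅ LC σ' ⋙ F')) ∧
    -- as objects of `M`, homotopy pullbacks are well defined up to zigzags of weak equivalences
    (∀ (X : WalkingCospan ⥤ M) κ σ κ' σ' (A A' : M),
      HoPullback.IsHomotopyPullback κ σ L (LC σ) X A →
      (HoPullback.IsHomotopyPullback κ' σ' L (LC σ') X A' ↔ HoPullback.WeqZigzag A A')) ∧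
    -- and are represented by the pullbacks of the weakly equivalent cospans with three fibrant
    -- nodes and at least one fibration
    (∀ {C D B C' D' B' : M} (g : C ⟶ D) (h : B ⟶ D) (g' : C' ⟶ D') (h' : B' ⟶ D')
      (c : C ⟶ C') (d : D ⟶ D') (b : B ⟶ B'),
      g ≫ d = c ≫ g' → h ≫ d = b ≫ h' →
      WeakEquivalence c → WeakEquivalence d → WeakEquivalence b →
      IsFibrant C' → IsFibrant D' → IsFibrant B' →
      Fibration g' ∨ Fibration h' →
      ∀ κ σ (A : M), HoPullback.IsHomotopyPullback κ σ L (LC σ) (cospan g h) A ↔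
        HoPullback.WeqZigzag A (pullback h' g')) := by
  refine ⟨fun σ ↦ ⟨HoPullback.isModelStructure_cospanClasses M σ,
    HoPullback.isQuillenAdjunction_cospanClasses M σ⟩, fun κ σ ↦ ?_, ?_, ?_, ?_⟩
  · exact HoPullback.exists_isRightDerived L (LC σ) (HoPullback.isModelStructure_cospanClasses M σ)
      (HoPullback.isQuillenAdjunction_cospanClasses M σ) κ
  · intro κ σ κ' σ' F F' hF hF'
    exact ⟨hF.nonempty_iso.some ≪≫ hF'.nonempty_iso.some.symm⟩
  · intro X κ σ κ' σ' A A' hA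
    rw [HoPullback.isHomotopyPullback_iff] at hA ⊢
    exact ⟨fun h ↦ .trans _ _ _ hA (.symm _ _ h), fun h ↦ .trans _ _ _ (.symm _ _ h) hA⟩
  · intro C D B C' D' B' g h g' h' c d b hg hh hc hd hb hC' hD' hB' hgh κ σ A
    obtain ⟨τ, hτ⟩ := HoPullback.exists_fib_cospan g' h' hgh
    let f : cospan g h ⟶ cospan g' h' := HoPullback.wideCospanHomMk d
      (fun | .left => c | .right => b) (by rintro (_ | _); exacts [hg, hh])
    have hf : (HoPullback.cospanClasses M τ).W f := by
      rw [HoPullback.cospanClasses_W]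
      rintro (_ | _ | _)
      exacts [hd.mem, hc.mem, hb.mem]
    have h₁ := HoPullback.weqZigzag_lim_of_fibrant τ f hf hτ
    -- The limit of the cospan is `C' ×_{D'} B'`, whereas the statement has the factors in the other
    -- order.
    have e : lim.obj (cospan g' h') ≅ pullback h' g' := pullbackSymmetry g' h'
    have h₂ : HoPullback.WeqZigzag (lim.obj (cospan g' h')) (pullback h' g') :=
      .rel _ _ ⟨e.hom, inferInstance⟩
    rw [HoPullback.isHomotopyPullback_iff]
    exact ⟨fun h ↦ .trans _ _ _ h (.trans _ _ _ h₁ h₂),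
      fun h ↦ .trans _ _ _ h (.symm _ _ (.trans _ _ _ h₁ h₂))⟩
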